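/- Tasks $\theta$ are drawn from a probability distribution $\eta$. A task is a Markov decision process with horizon $H\ge 1$, with state space $\mathcal S$ and finite action space $\mathcal A$, $|\mathcal A|=K$, common to all tasks, and with its own transition function, initial state distribution and cost function $C_\theta:\mathcal S\times\mathcal A\to[0,1]$. It comes with a stationary expert policy $\pi^*_\theta$, which for $\eta$-almost every $\theta$ is deterministic. $J_\theta(\pi)$ denotes the expected total cost of $\pi$ over $H$ steps. Let $\mu_\theta$ be the law of $(s,a)$, where $s$ follows the average over the $H$ levels of the state distributions induced by $\pi^*_\theta$ and $a\sim\pi^*_\theta(s)$. Let $\Phi$ be a finite set of measurable maps $\phi:\mathcal S\to\mathbb R^d$ with $\|\phi(s)\|_2\le R$ for all $s$, and for $\phi\in\Phi$ let $\Pi^\phi$ be the set of policies $\pi(a\mid s)=\mathrm{softmax}(W\phi(s))_a$ with $W\in\mathbb R^{K\times d}$, $\|W\|_F\le 1$. Assume that for some $\gamma<1/2$ there is $\phi^*\in\Phi$ such that for $\eta$-almost every $\theta$ some $\pi_\theta\in\Pi^{\phi^*}$ satisfies $\pi_\theta(\pi^*_\theta(s)\mid s)\ge 1-\gamma$ for all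 $s\in\mathcal S$. For a dataset $\mathbf x=((s_j,a_j))_{j\le n}$ let $\ell^{\mathbf x}(\pi)=\frac1n\sum_{j=1}^n-\log\pi(a_j\mid s_j)$, and let $\pi^{\phi,\mathbf x}\in\arg\min_{\pi\in\Pi^\phi}\ell^{\mathbf x}(\pi)$, with minimizing parameter $W$ chosen measurably in $\mathbf x$. The training data $\mathbf X=(\mathbf x^{(1)},\dots,\mathbf x^{(T)})$ are obtained by drawing tasks $\theta_1,\dots,\theta_T$ independently from $\eta$ and then, independently given the tasks, $\mathbf x^{(t)}\sim\mu_{\theta_t}^n$. Let $\hat\phi=\hat\phi(\mathbf X)\in\arg\min_{\phi\in\Phi}\frac1T\sum_{t=1}^T\min_{\pi\in\Pi^\phi}\ell^{\mathbf x^{(t)}}(\pi)$. There are universal constants $c_1,c_2>0$ such that in every such setting, and for all $\varepsilon>0$ and $\delta\in(0,1)$, if $$T\ge c_1\max\left\{\frac{H^4R^2\log|\Phi|}{\varepsilon^2},\frac{H^4\ln(4/\delta)}{\varepsilon^2}\right\}\quad\text{and}\quad n\ge c_2\frac{H^4R^2K}{\varepsilon^2},$$ then with probability at least $1-\delta$ over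 $\mathbf X$, $$\mathbb E_{\theta\sim\eta}\,\mathbb E_{\mathbf x\sim\mu_\theta^n}J_\theta(\pi^{\hat\phi,\mathbf x})-\mathbb E_{\theta\sim\eta}J_\theta(\pi^*_\theta)\le H^2\gamma+\varepsilon .$$ In particular the required number $n$ of samples per task does not depend on $\Phi$ except through $R$. -/

import Mathlib

open MeasureTheory ProbabilityTheory
open scoped ENNReal

namespace ImitationLearning

/-! ### Random Markov decision processes with experts -/

/-- A family of imitation learning tasks, indexed by a measurable space `Θ`, with common measurable
state space `S` and common action space `A`. The task with index `θ` is the MDP with initial state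
distribution `init θ`, transition function `(s, a) ↦ trans ((θ, s), a)` and cost function `cost θ`
with values in `[0, 1]`, together with the (stationary, possibly stochastic) expert policy
`s ↦ expert (θ, s)`. A distribution over tasks is a probability measure on `Θ`. -/
structure TaskFamily (Θ S A : Type*) [MeasurableSpace Θ] [MeasurableSpace S]
    [MeasurableSpace A] where
  init : Kernel Θ S
  trans : Kernel ((Θ × S) × A) S
  cost : Θ → S → A → ℝ
  expert : Kernel (Θ × S) A
  init_markov : IsMarkovKernel init
  trans_markov : IsMarkovKernel trans
  expert_markov : IsMarkovKernel expert
  cost_measurable : Measurable fun p : (Θ × S) × A => cost p.1.1 p.1.2 p.2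
  cost_nonneg : ∀ θ s a, 0 ≤ cost θ s a
  cost_le_one : ∀ θ s a, cost θ s a ≤ 1

attribute [instance] TaskFamily.init_markov TaskFamily.trans_markov TaskFamily.expert_markov

lemma measurable_consStep {Θ S A : Type*} [MeasurableSpace Θ] [MeasurableSpace S]
    [MeasurableSpace A] (m : ℕ) :
    Measurable fun y : (Θ × S) × ((A × S) × (Fin m → S × A)) =>
      (Fin.cons (y.1.2, y.2.1.1) y.2.2 : Fin (m + 1) → S × A) := by
  refine measurable_pi_lambda _ fun i => ?_
  refine Fin.cases ?_ (fun j => ?_) i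
  · simp only [Fin.cons_zero]
    fun_prop
  · simp only [Fin.cons_succ]
    fun_prop

/-- The law of `n` independent samples from `κ θ`, as a kernel in `θ`. -/
noncomputable def iidKernel {Θ β : Type*} [MeasurableSpace Θ] [MeasurableSpace β] (n : ℕ)
    (κ : Kernel Θ β) [IsMarkovKernel κ] : Kernel Θ (Fin n → β) where
  toFun θ := Measure.pi fun _ => κ θ
  measurable' := by
    refine Measurable.measure_of_isPiSystem_of_isProbabilityMeasure generateFrom_pi.symm
      isPiSystem_pi ?_
    rintro _ ⟨s, hs, rfl⟩
    simp only [Measure.pi_pi]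
    exact Finset.measurable_prod _ fun i _ => κ.measurable_coe (hs i (Set.mem_univ i))

instance {Θ β : Type*} [MeasurableSpace Θ] [MeasurableSpace β] (n : ℕ) (κ : Kernel Θ β)
    [IsMarkovKernel κ] : IsMarkovKernel (iidKernel n κ) :=
  ⟨fun θ => inferInstanceAs (IsProbabilityMeasure (Measure.pi fun _ : Fin n => κ θ))⟩

namespace TaskFamily

variable {Θ S A : Type*} [MeasurableSpace Θ] [MeasurableSpace S] [MeasurableSpace A]
  (𝓜 : TaskFamily Θ S A)

/-- `rollout π m (θ, s)` is the law of the first `m` state-action pairs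
`(s₁, a₁), …, (sₘ, aₘ)` in task `θ` when `s₁ = s`, `aᵢ ∼ π (θ, sᵢ)` and
`sᵢ₊₁ ∼ trans ((θ, sᵢ), aᵢ)`. -/
noncomputable def rollout (π : Kernel (Θ × S) A) : (m : ℕ) → Kernel (Θ × S) (Fin m → S × A)
  | 0 => Kernel.const _ (Measure.dirac Fin.elim0)
  | m + 1 =>
    (Kernel.id ×ₖ ((π ⊗ₖ 𝓜.trans) ⊗ₖ
      (rollout π m).comap (fun p : (Θ × S) × (A × S) => (p.1.1, p.2.2)) (by fun_prop))).map
      fun y => Fin.cons (y.1.2, y.2.1.1) y.2.2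

instance rollout_markov (π : Kernel (Θ × S) A) [IsMarkovKernel π] :
    (m : ℕ) → IsMarkovKernel (𝓜.rollout π m)
  | 0 => by unfold rollout; infer_instance
  | m + 1 => by
    have := rollout_markov π m
    unfold rollout
    exact Kernel.IsMarkovKernel.map _ (measurable_consStep m)

/-- The law of the random trajectory `(s₁, a₁), …, (s_H, a_H)` induced by `π` in task `θ`, with
`s₁` drawn from the initial state distribution. -/
noncomputable def trajectory (H : ℕ) (π : Kernel (Θ × S) A) : Kernel Θ (Fin H → S × A) :=
  (𝓜.init ⊗ₖ 𝓜.rollout π H).snd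

instance (H : ℕ) (π : Kernel (Θ × S) A) [IsMarkovKernel π] :
    IsMarkovKernel (𝓜.trajectory H π) := by
  unfold trajectory; infer_instance

/-- The distribution over states induced by `π` at a level. -/
noncomputable def stateDist (H : ℕ) (π : Kernel (Θ × S) A) (h : Fin H) : Kernel Θ S :=
  (𝓜.trajectory H π).map fun τ => (τ h).1

instance (H : ℕ) (π : Kernel (Θ × S) A) [IsMarkovKernel π] (h : Fin H) :
    IsMarkovKernel (𝓜.stateDist H π h) :=
  Kernel.IsMarkovKernel.map _ (by fun_prop)

/-- The average over the `H` levels of the state distributions induced by `π`. -/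
noncomputable def avgStateDist (H : ℕ) (π : Kernel (Θ × S) A) : Kernel Θ S where
  toFun θ := (H : ℝ≥0∞)⁻¹ • ∑ h : Fin H, 𝓜.stateDist H π h θ
  measurable' := by
    refine Measure.measurable_of_measurable_coe _ fun s hs => ?_
    simp only [Measure.smul_apply, Measure.finsetSum_apply, smul_eq_mul]
    exact (Finset.measurable_sum _ fun h _ => Kernel.measurable_coe _ hs).const_mul _

instance (H : ℕ) [NeZero H] (π : Kernel (Θ × S) A) [IsMarkovKernel π] :
    IsMarkovKernel (𝓜.avgStateDist H π) := by
  refine ⟨fun θ => ⟨?_⟩⟩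
  change ((H : ℝ≥0∞)⁻¹ • ∑ h : Fin H, 𝓜.stateDist H π h θ) Set.univ = 1
  simp only [Measure.smul_apply, Measure.finsetSum_apply, measure_univ, smul_eq_mul,
    Finset.sum_const, Finset.card_univ, Fintype.card_fin, nsmul_eq_mul, mul_one]
  exact ENNReal.inv_mul_cancel (by simpa using NeZero.ne H) (ENNReal.natCast_ne_top H)

/-- The distribution of a demonstration `(s, a)` for task `θ`: the state `s` is drawn from the
average state distribution of the expert and `a` from the expert policy at `s`. -/
noncomputable def demo (H : ℕ) : Kernel Θ (S × A) :=
  𝓜.avgStateDist H 𝓜.expert ⊗ₖ 𝓜.expert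

instance (H : ℕ) [NeZero H] : IsMarkovKernel (𝓜.demo H) := by
  unfold demo; infer_instance

/-- The expected cost incurred in task `θ` by `π` in the `m` remaining steps, starting at `s`; the
value function at level `h` is the case `m = H - h + 1`. -/
noncomputable def value (π : Kernel (Θ × S) A) (m : ℕ) (θ : Θ) (s : S) : ℝ :=
  ∫ τ, ∑ i, 𝓜.cost θ (τ i).1 (τ i).2 ∂(𝓜.rollout π m (θ, s))

/-- The expected cost `J_θ(π)` with horizon `H`. -/
noncomputable def expectedCost (H : ℕ) (π : Kernel (Θ × S) A) (θ : Θ) : ℝ :=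
  ∫ s, 𝓜.value π H θ s ∂(𝓜.init θ)

/-- The law of the dataset for one task drawn from `η`: `n` demonstrations that are independent
given the task. -/
noncomputable def taskDataLaw (η : Measure Θ) (H n : ℕ) [NeZero H] : Measure (Fin n → S × A) :=
  η.bind (iidKernel n (𝓜.demo H))

/-- The law of the datasets for `T` training tasks drawn independently from `η`. -/
noncomputable def trainLaw (η : Measure Θ) (H T n : ℕ) [NeZero H] :
    Measure (Fin T → Fin n → S × A) :=
  Measure.pi fun _ => 𝓜.taskDataLaw η H n

/-- The expert policy of task `θ` is deterministic. -/
def DeterministicExpert (θ : Θ) : Prop :=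
  ∀ s, ∃ a, 𝓜.expert (θ, s) = Measure.dirac a

end TaskFamily

/-! ### Representations and softmax-linear policies -/

/-- Measurable maps from states to vectors. -/
abbrev Representation (S : Type*) [MeasurableSpace S] (d : ℕ) :=
  {φ : S → EuclideanSpace ℝ (Fin d) // Measurable φ}

section Policies

variable {S A : Type*} [MeasurableSpace S] [Fintype A] {d : ℕ}

noncomputable def softmax (v : A → ℝ) (a : A) : ℝ :=
  Real.exp (v a) / ∑ b, Real.exp (v b)

/-- The matrices with Frobenius norm at most one. -/
def FrobeniusBall (A : Type*) [Fintype A] (d : ℕ) : Set (Matrix A (Fin d) ℝ) :=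
  {W | Real.sqrt (∑ a, ∑ j, W a j ^ 2) ≤ 1}

/-- The probability `softmax(W φ(s))_a` of the action `a` at the state `s`. -/
noncomputable def actionProb (φ : S → EuclideanSpace ℝ (Fin d)) (W : Matrix A (Fin d) ℝ)
    (s : S) (a : A) : ℝ :=
  softmax (W.mulVec (φ s).ofLp) a

lemma measurable_actionProb (φ : Representation S d) (W : Matrix A (Fin d) ℝ) (a : A) :
    Measurable fun s => actionProb φ.1 W s a := by
  have h : ∀ b, Measurable fun s => W.mulVec (φ.1 s).ofLp b := fun b => by
    have hφ := φ.2
    simp only [Matrix.mulVec, dotProduct]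
    fun_prop
  unfold actionProb softmax
  fun_prop

variable {Θ : Type*} [MeasurableSpace Θ] [MeasurableSpace A]

/-- The policy which at the state `s` plays the action `a` with probability
`softmax(W φ(s))_a`. -/
noncomputable def softmaxPolicy (φ : Representation S d) (W : Matrix A (Fin d) ℝ) :
    Kernel S A where
  toFun s := ∑ a, ENNReal.ofReal (actionProb φ.1 W s a) • Measure.dirac a
  measurable' := by
    refine Measure.measurable_of_measurable_coe _ fun t _ => ?_
    simp only [Measure.finsetSum_apply, Measure.smul_apply, smul_eq_mul]
    exact Finset.measurable_sum _ fun a _ =>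
      (measurable_actionProb φ W a).ennreal_ofReal.mul_const _

instance [Nonempty A] (φ : Representation S d) (W : Matrix A (Fin d) ℝ) :
    IsMarkovKernel (softmaxPolicy φ W) := by
  refine ⟨fun s => ⟨?_⟩⟩
  change (∑ a, ENNReal.ofReal (actionProb φ.1 W s a) • Measure.dirac a) Set.univ = 1
  have h0 : 0 < ∑ b, Real.exp (W.mulVec (φ.1 s).ofLp b) :=
    Finset.sum_pos (fun b _ => Real.exp_pos _) Finset.univ_nonempty
  simp only [Measure.finsetSum_apply, Measure.smul_apply, measure_univ, smul_eq_mul, mul_one]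
  simp only [actionProb, softmax]
  rw [← ENNReal.ofReal_sum_of_nonneg fun a _ => div_nonneg (Real.exp_pos _).le h0.le]
  simp only [← Finset.sum_div, div_self h0.ne', ENNReal.ofReal_one]

/-- The average logistic loss on the dataset `x` of the policy given by `φ` and `W`. -/
noncomputable def empLoss {n : ℕ} (φ : Representation S d) (W : Matrix A (Fin d) ℝ)
    (x : Fin n → S × A) : ℝ :=
  (1 / (n : ℝ)) * ∑ j, -Real.log (actionProb φ.1 W (x j).1 (x j).2)

/-- The outer empirical loss of a representation: the average over the training tasks of the
smallest empirical loss of a policy using that representation. -/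
noncomputable def outerLoss {T n : ℕ} (φ : Representation S d) (X : Fin T → Fin n → S × A) : ℝ :=
  (1 / (T : ℝ)) * ∑ t, ⨅ W : FrobeniusBall A d, empLoss φ W.1 (X t)

/-- `erm φ x` is, for every representation `φ` in the class `Φ` and every dataset `x`, a minimizer
of the empirical loss, selected measurably in `x`. -/
structure IsERM {n : ℕ} (Φ : Finset (Representation S d))
    (erm : Representation S d → (Fin n → S × A) → Matrix A (Fin d) ℝ) : Prop where
  mem : ∀ φ ∈ Φ, ∀ x, erm φ x ∈ FrobeniusBall A d
  le : ∀ φ ∈ Φ, ∀ x, ∀ W ∈ FrobeniusBall A d, empLoss φ (erm φ x) x ≤ empLoss φ W x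
  measurable : ∀ φ ∈ Φ, ∀ a j, Measurable fun x => erm φ x a j

/-- Some policy that uses `φ` gives, at every state, probability at least `1 - γ` to the action of
the (deterministic) expert of task `θ`. -/
def TaskFamily.Realizes (𝓜 : TaskFamily Θ S A) (φ : Representation S d) (γ : ℝ) (θ : Θ) : Prop :=
  ∃ W ∈ FrobeniusBall A d, ∀ s a, 𝓜.expert (θ, s) = Measure.dirac a →
    1 - γ ≤ actionProb φ.1 W s a

/-- The average excess cost on a new task: a task is drawn from `η`, then `n` demonstrations from
that task, and the policy learned from them with the representation `φ` is compared with the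
expert. -/
noncomputable def TaskFamily.excessCost (𝓜 : TaskFamily Θ S A) (η : Measure Θ) (H n : ℕ)
    [NeZero H] (erm : Representation S d → (Fin n → S × A) → Matrix A (Fin d) ℝ)
    (φ : Representation S d) : ℝ :=
  (∫ θ, ∫ x, 𝓜.expectedCost H (Kernel.prodMkLeft Θ (softmaxPolicy φ (erm φ x))) θ
      ∂(iidKernel n (𝓜.demo H) θ) ∂η)
    - ∫ θ, 𝓜.expectedCost H 𝓜.expert θ ∂η

end Policies

end ImitationLearning

/-! The proof never controls the logarithmic loss uniformly. It works with its exponential. For a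
fixed representation φ and a dataset x of one task, let Y(x) be exp of minus the minimal empirical
loss, which is a geometric mean of fitted action probabilities. By Jensen's inequality Y(x) is at
most the arithmetic mean of these probabilities (`exp_neg_empLoss_le`). Symmetrization and vector
contraction for the bounded functions softmax(Wφ(s))_a then give E Y ≤ agreement + 8 √(K R² / n),
where the agreement is the expected probability of the demonstrated action on a fresh demonstration
(`integral_exp_neg_empLoss_le`). Only one φ is involved here, so n does not depend on the size of Φ.

Behaviour cloning bounds the excess cost by H² (1 - agreement) (`excessCost_le`): each disagreement
with the expert costs at most H, and there are H levels. Put e = ε / H². A representation whose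
excess cost exceeds H²γ + ε has agreement below 1 - γ - e, hence E Y ≤ 1 - γ - e/2 once n is large.

The realizing representation almost surely has outer loss at most -log(1 - γ), so the minimizer φ̂
does too, and Jensen's inequality across tasks makes the empirical average of Y for φ̂ at least 1 -
γ. For a fixed bad φ this is an upward deviation by e/2 of an average of T independent variables
lying in an interval of length min(1, 2R), and Hoeffding's inequality (`measure_pi_average_ge_le`)
bounds its probability by δ / |Φ|. A union bound over the bad representations finishes the proof.
Since exp(log(1 - γ)) = 1 - γ, the coefficient of H²γ is exactly one. -/

namespace ImitationLearning

/-! ### Softmax policies -/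

section Softmax

variable {S A : Type*} [Fintype A] {d : ℕ}

lemma sum_exp_pos (v : A → ℝ) (a : A) : 0 < ∑ b, Real.exp (v b) :=
  Finset.sum_pos (fun _ _ => Real.exp_pos _) ⟨a, Finset.mem_univ a⟩

lemma softmax_pos (v : A → ℝ) (a : A) : 0 < softmax v a :=
  div_pos (Real.exp_pos _) (sum_exp_pos v a)

lemma softmax_le_one (v : A → ℝ) (a : A) : softmax v a ≤ 1 :=
  (div_le_one (sum_exp_pos v a)).2
    (Finset.single_le_sum (f := fun b => Real.exp (v b)) (fun _ _ => (Real.exp_pos _).le)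
      (Finset.mem_univ a))

lemma softmax_zero (a : A) : softmax (0 : A → ℝ) a = (Fintype.card A : ℝ)⁻¹ := by
  simp [softmax]

/-- Moving every logit by at most M changes the numerator and the normalizer by factors within
e^(±M), hence the quotient by at most e^(2M). Then e^(-2M) ≥ 1 - 2M and softmax ≤ 1 give the
additive form. -/
lemma softmax_sub_le {v w : A → ℝ} {M : ℝ} (h : ∀ b, |v b - w b| ≤ M) (a : A) :
    softmax v a - softmax w a ≤ 2 * M := by
  have key : softmax v a * Real.exp (-(2 * M)) ≤ softmax w a := by
    rw [softmax, softmax, div_mul_eq_mul_div, div_le_div_iff₀ (sum_exp_pos v a) (sum_exp_pos w a),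
      Finset.mul_sum, Finset.mul_sum]
    refine Finset.sum_le_sum fun b _ => ?_
    rw [← Real.exp_add, ← Real.exp_add, ← Real.exp_add]
    refine Real.exp_le_exp.2 ?_
    have h1 := abs_le.1 (h a)
    have h2 := abs_le.1 (h b)
    linarith [h1.1, h1.2, h2.1, h2.2]
  have h0 := (softmax_pos v a).le
  have h1 := softmax_le_one v a
  have h3 : 0 ≤ M := (abs_nonneg _).trans (h a)
  have h2 := Real.add_one_le_exp (-(2 * M))
  nlinarith

lemma abs_softmax_sub_le {v w : A → ℝ} {M : ℝ} (h : ∀ b, |v b - w b| ≤ M) (a : A) :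
    |softmax v a - softmax w a| ≤ 2 * M := by
  refine abs_le.2 ⟨?_, softmax_sub_le h a⟩
  have := softmax_sub_le (v := w) (w := v) (fun b => by rw [abs_sub_comm]; exact h b) a
  linarith

lemma actionProb_pos (φ : S → EuclideanSpace ℝ (Fin d)) (W : Matrix A (Fin d) ℝ) (s : S) (a : A) :
    0 < actionProb φ W s a := softmax_pos _ _

lemma actionProb_le_one (φ : S → EuclideanSpace ℝ (Fin d)) (W : Matrix A (Fin d) ℝ) (s : S)
    (a : A) : actionProb φ W s a ≤ 1 := softmax_le_one _ _

lemma actionProb_zero (φ : S → EuclideanSpace ℝ (Fin d)) (s : S) (a : A) :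
    actionProb φ 0 s a = (Fintype.card A : ℝ)⁻¹ := by
  rw [actionProb, Matrix.zero_mulVec, softmax_zero]

lemma sum_sq_le_one_of_mem_frobeniusBall {W : Matrix A (Fin d) ℝ} (hW : W ∈ FrobeniusBall A d) :
    ∑ a, ∑ j, W a j ^ 2 ≤ 1 := by
  have h : Real.sqrt (∑ a, ∑ j, W a j ^ 2) ≤ 1 := hW
  simpa using (Real.sqrt_le_iff.1 h).2

lemma zero_mem_frobeniusBall : (0 : Matrix A (Fin d) ℝ) ∈ FrobeniusBall A d := by
  simp [FrobeniusBall]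

lemma abs_mulVec_le {W : Matrix A (Fin d) ℝ} (hW : W ∈ FrobeniusBall A d)
    (x : EuclideanSpace ℝ (Fin d)) (a : A) : |W.mulVec x.ofLp a| ≤ ‖x‖ := by
  rw [EuclideanSpace.norm_eq]
  refine Real.abs_le_sqrt ?_
  simp only [Matrix.mulVec, dotProduct, Real.norm_eq_abs, sq_abs]
  have h1 : ∑ j, W a j ^ 2 ≤ 1 :=
    (Finset.single_le_sum (f := fun a => ∑ j, W a j ^ 2)
      (fun b _ => Finset.sum_nonneg fun j _ => sq_nonneg _) (Finset.mem_univ a)).trans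
      (sum_sq_le_one_of_mem_frobeniusBall hW)
  have h2 : 0 ≤ ∑ j, x.ofLp j ^ 2 := Finset.sum_nonneg fun j _ => sq_nonneg _
  calc (∑ j, W a j * x.ofLp j) ^ 2 ≤ (∑ j, W a j ^ 2) * ∑ j, x.ofLp j ^ 2 :=
        Finset.sum_mul_sq_le_sq_mul_sq _ _ _
    _ ≤ 1 * ∑ j, x.ofLp j ^ 2 := by gcongr
    _ = ∑ j, x.ofLp j ^ 2 := one_mul _

/-- All logits have absolute value at most ‖φ s‖, so a policy of the class is close to the uniform
one, which is the case W = 0. This is the source of the factor R² beside log |Φ|. -/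
lemma abs_actionProb_sub_inv_card_le {φ : S → EuclideanSpace ℝ (Fin d)} {R : ℝ}
    (hφ : ∀ s, ‖φ s‖ ≤ R) {W : Matrix A (Fin d) ℝ} (hW : W ∈ FrobeniusBall A d) (s : S) (a : A) :
    |actionProb φ W s a - (Fintype.card A : ℝ)⁻¹| ≤ 2 * R := by
  rw [← actionProb_zero φ s a]
  refine abs_softmax_sub_le (fun b => ?_) a
  rw [Matrix.zero_mulVec, Pi.zero_apply, sub_zero]
  exact (abs_mulVec_le hW _ b).trans (hφ s)

/-- The sup-norm Lipschitz bound is weakened to the Euclidean norm, the form that vector contraction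
requires. -/
lemma abs_actionProb_sub_le (φ : S → EuclideanSpace ℝ (Fin d)) (W W' : Matrix A (Fin d) ℝ) (s : S)
    (a : A) : |actionProb φ W s a - actionProb φ W' s a| ≤
      2 * Real.sqrt (∑ b, (W.mulVec (φ s).ofLp b - W'.mulVec (φ s).ofLp b) ^ 2) :=
  abs_softmax_sub_le (fun b => Real.abs_le_sqrt
    (Finset.single_le_sum (f := fun b => (W.mulVec (φ s).ofLp b - W'.mulVec (φ s).ofLp b) ^ 2)
      (fun _ _ => sq_nonneg _) (Finset.mem_univ b))) a

end Softmax

/-! ### Rademacher averages and vector contraction -/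

section Rademacher

open scoped BigOperators

/-- The sign attached to a Boolean. -/
def sgn (b : Bool) : ℝ := if b then 1 else -1

lemma sgn_true : sgn true = 1 := rfl

lemma sgn_false : sgn false = -1 := rfl

lemma sgn_not (b : Bool) : sgn (!b) = -sgn b := by cases b <;> simp [sgn]

lemma expect_bool (f : Bool → ℝ) : 𝔼 b, f b = (f true + f false) / 2 := by
  rw [Fintype.expect_eq_sum_div_card]; simp

/-- Averages over sign vectors are invariant under flipping one coordinate. -/
lemma expect_update_not {ι : Type*} [Fintype ι] [DecidableEq ι] (i : ι) (f : (ι → Bool) → ℝ) :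
    𝔼 τ : ι → Bool, f (Function.update τ i (!τ i)) = 𝔼 τ, f τ :=
  Fintype.expect_equiv
    (Function.Involutive.toPerm (fun τ : ι → Bool => Function.update τ i (!τ i)) fun τ => by simp)
    _ _ fun τ => rfl

lemma expect_not {ι : Type*} [Fintype ι] [DecidableEq ι] (f : (ι → Bool) → ℝ) :
    𝔼 τ : ι → Bool, f (fun i => !τ i) = 𝔼 τ, f τ :=
  Fintype.expect_equiv
    (Function.Involutive.toPerm (fun (τ : ι → Bool) i => !τ i) fun τ => by simp)
    _ _ fun τ => rfl

lemma expect_fin_succ {β : Type*} [Fintype β] (n : ℕ) (f : (Fin (n + 1) → β) → ℝ) :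
    𝔼 σ, f σ = 𝔼 b : β, 𝔼 σ : Fin n → β, f (Fin.cons b σ) := by
  rw [← Finset.expect_product', Finset.univ_product_univ]
  exact (Fintype.expect_equiv (Fin.consEquiv fun _ => β) _ _ fun p => rfl).symm

/-- One coordinate of a sign sum, with the others fixed, can be averaged over its two values. -/
lemma expect_signSum_insert {ι : Type*} [Fintype ι] [DecidableEq ι] (v : ι → ℝ) (g : ℝ → ℝ)
    {i : ι} {s : Finset ι} (hi : i ∉ s) :
    𝔼 τ : ι → Bool, g (∑ j ∈ insert i s, sgn (τ j) * v j) =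
      𝔼 τ : ι → Bool, (g (∑ j ∈ s, sgn (τ j) * v j + v i) +
        g (∑ j ∈ s, sgn (τ j) * v j - v i)) / 2 := by
  have h1 : ∀ τ : ι → Bool, ∑ j ∈ s, sgn (Function.update τ i (!τ i) j) * v j =
      ∑ j ∈ s, sgn (τ j) * v j := fun τ => Finset.sum_congr rfl fun j hj => by
    rw [Function.update_of_ne (ne_of_mem_of_not_mem hj hi)]
  have h2 := expect_update_not i fun τ => g (∑ j ∈ insert i s, sgn (τ j) * v j)
  have h3 : 𝔼 τ : ι → Bool, g (∑ j ∈ insert i s, sgn (τ j) * v j) =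
      (𝔼 τ : ι → Bool, g (∑ j ∈ insert i s, sgn (τ j) * v j) +
        𝔼 τ : ι → Bool, g (∑ j ∈ insert i s, sgn (Function.update τ i (!τ i) j) * v j)) / 2 := by
    rw [h2]; ring
  rw [h3, ← Finset.expect_add_distrib, Finset.expect_div]
  refine Finset.expect_congr rfl fun τ _ => ?_
  simp only [Finset.sum_insert hi, h1, Function.update_self, sgn_not]
  cases τ i <;> simp only [sgn_true, sgn_false] <;> ring_nf

lemma expect_signSum_sq {ι : Type*} [Fintype ι] [DecidableEq ι] (v : ι → ℝ) (s : Finset ι) :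
    𝔼 τ : ι → Bool, (∑ j ∈ s, sgn (τ j) * v j) ^ 2 = ∑ j ∈ s, v j ^ 2 := by
  induction s using Finset.induction_on with
  | empty => simp
  | insert i s hi ih =>
    rw [expect_signSum_insert v (· ^ 2) hi, Finset.sum_insert hi, ← ih,
      ← Fintype.expect_const (ι := ι → Bool) (v i ^ 2), ← Finset.expect_add_distrib]
    exact Finset.expect_congr rfl fun τ _ => by ring

/-- Averaging over the new sign cancels the odd powers and leaves S⁴ + 6 v² S² + v⁴, which fits
under 3 (A + v²)² when E S² = A and E S⁴ ≤ 3A². -/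
lemma expect_signSum_pow_four_le {ι : Type*} [Fintype ι] [DecidableEq ι] (v : ι → ℝ)
    (s : Finset ι) :
    𝔼 τ : ι → Bool, (∑ j ∈ s, sgn (τ j) * v j) ^ 4 ≤ 3 * (∑ j ∈ s, v j ^ 2) ^ 2 := by
  induction s using Finset.induction_on with
  | empty => simp
  | insert i s hi ih =>
    have h : 𝔼 τ : ι → Bool, (∑ j ∈ insert i s, sgn (τ j) * v j) ^ 4 =
        𝔼 τ : ι → Bool, (∑ j ∈ s, sgn (τ j) * v j) ^ 4 +
          6 * v i ^ 2 * 𝔼 τ : ι → Bool, (∑ j ∈ s, sgn (τ j) * v j) ^ 2 + v i ^ 4 := by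
      rw [expect_signSum_insert v (· ^ 4) hi, Finset.mul_expect,
        ← Fintype.expect_const (ι := ι → Bool) (v i ^ 4), ← Finset.expect_add_distrib,
        ← Finset.expect_add_distrib]
      exact Finset.expect_congr rfl fun τ _ => by ring
    rw [h, expect_signSum_sq, Finset.sum_insert hi]
    nlinarith [sq_nonneg (v i ^ 2)]

/-- A form of Khintchine's inequality. -/
lemma sqrt_sum_sq_le_expect_abs {ι : Type*} [Fintype ι] [DecidableEq ι] (v : ι → ℝ) :
    Real.sqrt (∑ j, v j ^ 2) ≤ 2 * 𝔼 τ : ι → Bool, |∑ j, sgn (τ j) * v j| := by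
  set r := Real.sqrt (∑ j, v j ^ 2) with hr
  have hr2 : r ^ 2 = ∑ j, v j ^ 2 := Real.sq_sqrt (Finset.sum_nonneg fun j _ => sq_nonneg _)
  have hE0 : 0 ≤ 𝔼 τ : ι → Bool, |∑ j, sgn (τ j) * v j| :=
    Finset.expect_nonneg fun τ _ => abs_nonneg _
  rcases (Real.sqrt_nonneg (∑ j, v j ^ 2)).eq_or_lt with h0 | h0
  · rw [hr, ← h0]; positivity
  rw [← hr] at h0
  have h4 := expect_signSum_pow_four_le v Finset.univ
  have h2 := expect_signSum_sq v Finset.univ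
  rw [← hr2] at h2 h4
  -- Pointwise this is |x| (|x| - 2r)² (|x| + 4r) ≥ 0. With second moment r² and fourth moment at
  -- most 3r⁴ it yields 9r ≤ 16 E|x|, and 16/9 is rounded up to 2.
  have key : 12 * r ^ 2 * (𝔼 τ : ι → Bool, (∑ j, sgn (τ j) * v j) ^ 2) -
      𝔼 τ : ι → Bool, (∑ j, sgn (τ j) * v j) ^ 4 ≤
        16 * r ^ 3 * 𝔼 τ : ι → Bool, |∑ j, sgn (τ j) * v j| := by
    rw [Finset.mul_expect, Finset.mul_expect, ← Finset.expect_sub_distrib]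
    refine Finset.expect_le_expect fun τ _ => ?_
    generalize ∑ j, sgn (τ j) * v j = x
    have hx : x ^ 2 = |x| ^ 2 := (sq_abs x).symm
    have hx4 : x ^ 4 = |x| ^ 4 := by rw [show x ^ 4 = (x ^ 2) ^ 2 by ring, hx]; ring
    rw [hx, hx4]
    have := mul_nonneg (abs_nonneg x) (mul_nonneg (sq_nonneg (|x| - 2 * r))
      (add_nonneg (abs_nonneg x) (by positivity : 0 ≤ 4 * r)))
    nlinarith
  have h5 : r ^ 3 * (9 * r) ≤ r ^ 3 * (16 * 𝔼 τ : ι → Bool, |∑ j, sgn (τ j) * v j|) := by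
    nlinarith
  have h6 := le_of_mul_le_mul_left h5 (by positivity)
  linarith

/-- The vector contraction inequality for a single summand. -/
lemma half_iSup_add_iSup_le {T ι : Type*} [Finite T] [Nonempty T] [Fintype ι] [DecidableEq ι]
    {L : ℝ} (hL : 0 ≤ L) (g h : T → ℝ) (u : T → ι → ℝ)
    (hh : ∀ t t', |h t - h t'| ≤ L * Real.sqrt (∑ a, (u t a - u t' a) ^ 2)) :
    𝔼 b : Bool, ⨆ t, (g t + sgn b * h t) ≤
      𝔼 ξ : ι → Bool, ⨆ t, (g t + 2 * L * ∑ a, sgn (ξ a) * u t a) := by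
  obtain ⟨t₁, h₁⟩ := exists_eq_ciSup_of_finite (f := fun t => g t + sgn true * h t)
  obtain ⟨t₂, h₂⟩ := exists_eq_ciSup_of_finite (f := fun t => g t + sgn false * h t)
  rw [expect_bool, ← h₁, ← h₂]
  have hK := sqrt_sum_sq_le_expect_abs fun a => u t₁ a - u t₂ a
  -- Negating all signs shows that the suprema with +ξ and with -ξ have the same average, so their
  -- sum can be bounded below instead.
  have hneg := expect_not fun ξ : ι → Bool => ⨆ t, (g t + 2 * L * ∑ a, sgn (ξ a) * u t a)
  have hstep : (g t₁ + g t₂ + 2 * L * 𝔼 ξ : ι → Bool, |∑ a, sgn (ξ a) * (u t₁ a - u t₂ a)|) ≤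
      𝔼 ξ : ι → Bool, ((⨆ t, (g t + 2 * L * ∑ a, sgn (ξ a) * u t a)) +
        ⨆ t, (g t + 2 * L * ∑ a, sgn (!ξ a) * u t a)) := by
    rw [← Fintype.expect_const (ι := ι → Bool) (g t₁ + g t₂), Finset.mul_expect,
      ← Finset.expect_add_distrib]
    refine Finset.expect_le_expect fun ξ _ => ?_
    simp only [sgn_not, neg_mul, Finset.sum_neg_distrib, mul_neg]
    have b1 : ∀ t, g t + 2 * L * ∑ a, sgn (ξ a) * u t a ≤
        ⨆ t, (g t + 2 * L * ∑ a, sgn (ξ a) * u t a) :=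
      le_ciSup (f := fun t => g t + 2 * L * ∑ a, sgn (ξ a) * u t a) (Set.finite_range _).bddAbove
    have b2 : ∀ t, g t + -(2 * L * ∑ a, sgn (ξ a) * u t a) ≤
        ⨆ t, (g t + -(2 * L * ∑ a, sgn (ξ a) * u t a)) :=
      le_ciSup (f := fun t => g t + -(2 * L * ∑ a, sgn (ξ a) * u t a))
        (Set.finite_range _).bddAbove
    simp only [mul_sub, Finset.sum_sub_distrib]
    -- The sign of the difference decides which maximizer is tested in which supremum; this is how
    -- the absolute value from Khintchine's inequality arises.
    rcases abs_cases (∑ a, sgn (ξ a) * u t₁ a - ∑ a, sgn (ξ a) * u t₂ a) with ⟨h, _⟩ | ⟨h, _⟩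
    · rw [h]; linarith [b1 t₁, b2 t₂]
    · rw [h]; linarith [b1 t₂, b2 t₁]
  rw [Finset.expect_add_distrib, hneg] at hstep
  have h3 := (le_abs_self _).trans (hh t₁ t₂)
  have h4 := mul_le_mul_of_nonneg_left hK hL
  rw [sgn_true, sgn_false]
  linarith

/-- The vector contraction inequality for Rademacher averages, over a finite index set. -/
lemma expect_iSup_signSum_le {T ι : Type*} [Finite T] [Nonempty T] [Fintype ι] [DecidableEq ι]
    {L : ℝ} (hL : 0 ≤ L) (n : ℕ) (g : T → ℝ) (h : Fin n → T → ℝ) (u : Fin n → T → ι → ℝ)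
    (hh : ∀ j t t', |h j t - h j t'| ≤ L * Real.sqrt (∑ a, (u j t a - u j t' a) ^ 2)) :
    𝔼 σ : Fin n → Bool, ⨆ t, (g t + ∑ j, sgn (σ j) * h j t) ≤
      𝔼 τ : Fin n → ι → Bool, ⨆ t, (g t + 2 * L * ∑ j, ∑ a, sgn (τ j a) * u j t a) := by
  -- The term g absorbs the summands not currently being contracted, so each step replaces a single
  -- sign by a vector of signs.
  induction n generalizing g with
  | zero => simp
  | succ n ih =>
    rw [expect_fin_succ, expect_fin_succ]
    simp only [Fin.sum_univ_succ, Fin.cons_zero, Fin.cons_succ]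
    calc 𝔼 b, 𝔼 σ : Fin n → Bool, ⨆ t, (g t + (sgn b * h 0 t + ∑ j : Fin n, sgn (σ j) * h j.succ t))
        = 𝔼 b, 𝔼 σ : Fin n → Bool,
            ⨆ t, ((g t + sgn b * h 0 t) + ∑ j : Fin n, sgn (σ j) * h j.succ t) := by
          simp only [add_assoc]
      _ ≤ 𝔼 b, 𝔼 τ : Fin n → ι → Bool, ⨆ t, ((g t + sgn b * h 0 t) +
            2 * L * ∑ j : Fin n, ∑ a, sgn (τ j a) * u j.succ t a) :=
          Finset.expect_le_expect fun b _ =>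
            ih (fun t => g t + sgn b * h 0 t) (fun j => h j.succ) (fun j => u j.succ)
              fun j => hh j.succ
      _ = 𝔼 τ : Fin n → ι → Bool, 𝔼 b, ⨆ t,
            ((g t + 2 * L * ∑ j : Fin n, ∑ a, sgn (τ j a) * u j.succ t a) + sgn b * h 0 t) := by
          rw [Finset.expect_comm]
          simp only [add_right_comm]
      _ ≤ 𝔼 τ : Fin n → ι → Bool, 𝔼 ξ : ι → Bool, ⨆ t,
            ((g t + 2 * L * ∑ j : Fin n, ∑ a, sgn (τ j a) * u j.succ t a) +
              2 * L * ∑ a, sgn (ξ a) * u 0 t a) :=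
          Finset.expect_le_expect fun τ _ => half_iSup_add_iSup_le hL _ _ _ (hh 0)
      _ = _ := by
          rw [Finset.expect_comm]
          simp only [mul_add, add_comm, add_left_comm]

/-- The Rademacher average of the linear maps in the Frobenius ball. -/
lemma expect_iSup_mulVec_le {T A : Type*} [Finite T] [Nonempty T] [Fintype A] [DecidableEq A]
    {n d : ℕ} {R : ℝ} (W : T → Matrix A (Fin d) ℝ) (hW : ∀ t, W t ∈ FrobeniusBall A d)
    (x : Fin n → EuclideanSpace ℝ (Fin d)) (hx : ∀ j, ‖x j‖ ≤ R) :
    𝔼 τ : Fin n → A → Bool, ⨆ t, ∑ j, ∑ a, sgn (τ j a) * (W t).mulVec (x j).ofLp a ≤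
      Real.sqrt (Fintype.card A * n * R ^ 2) := by
  set V : (Fin n → A → Bool) → ℝ := fun τ => ∑ a, ∑ i, (∑ j, sgn (τ j a) * x j i) ^ 2 with hV
  have hV0 : ∀ τ, 0 ≤ V τ := fun τ =>
    Finset.sum_nonneg fun a _ => Finset.sum_nonneg fun i _ => sq_nonneg _
  have h1 : ∀ τ : Fin n → A → Bool,
      ⨆ t, ∑ j, ∑ a, sgn (τ j a) * (W t).mulVec (x j).ofLp a ≤ Real.sqrt (V τ) := fun τ => by
    refine ciSup_le fun t => Real.le_sqrt_of_sq_le ?_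
    -- The sum is the Frobenius inner product of W with the matrix of signed feature sums, so
    -- Cauchy–Schwarz removes the supremum. Its mean square is then K Σ ‖x_j‖².
    have e : ∑ j, ∑ a, sgn (τ j a) * (W t).mulVec (x j).ofLp a =
        ∑ p : A × Fin d, W t p.1 p.2 * ∑ j, sgn (τ j p.1) * x j p.2 := by
      rw [Fintype.sum_prod_type]
      simp only [Matrix.mulVec, dotProduct, Finset.mul_sum]
      rw [Finset.sum_comm]
      refine Finset.sum_congr rfl fun a _ => ?_
      rw [Finset.sum_comm]
      exact Finset.sum_congr rfl fun i _ => Finset.sum_congr rfl fun j _ => by ring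
    rw [e]
    refine (Finset.sum_mul_sq_le_sq_mul_sq _ _ _).trans ?_
    rw [Fintype.sum_prod_type, Fintype.sum_prod_type]
    exact mul_le_of_le_one_left (hV0 τ) (sum_sq_le_one_of_mem_frobeniusBall (hW t))
  have h2 : (𝔼 τ, Real.sqrt (V τ)) ^ 2 ≤ 𝔼 τ, V τ := by
    have := Finset.expect_mul_sq_le_sq_mul_sq Finset.univ (fun τ => Real.sqrt (V τ)) fun _ => 1
    simpa only [mul_one, one_pow, Fintype.expect_const, Real.sq_sqrt (hV0 _)] using this
  have h3 : 𝔼 τ, V τ ≤ Fintype.card A * n * R ^ 2 := by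
    have e : ∀ (a : A) (i : Fin d), 𝔼 τ : Fin n → A → Bool, (∑ j, sgn (τ j a) * x j i) ^ 2 =
        ∑ j, x j i ^ 2 := fun a i => by
      -- The signs are indexed by pairs; coefficients vanishing off row a reduce to the scalar
      -- second moment.
      have := expect_signSum_sq (fun p : Fin n × A => if p.2 = a then x p.1 i else 0) Finset.univ
      simp only [Fintype.sum_prod_type, mul_ite, mul_zero, Finset.sum_ite_eq', Finset.mem_univ,
        if_true, ite_pow, ne_eq, OfNat.ofNat_ne_zero, not_false_eq_true, zero_pow] at this
      rw [← this]
      exact Fintype.expect_equiv (Equiv.curry _ _ _).symm _ _ fun τ => rfl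
    simp only [hV]
    rw [Finset.expect_sum_comm]
    simp only [Finset.expect_sum_comm, e]
    rw [Finset.sum_const, Finset.card_univ, nsmul_eq_mul, mul_assoc]
    refine mul_le_mul_of_nonneg_left ?_ (Nat.cast_nonneg _)
    rw [Finset.sum_comm]
    calc ∑ j, ∑ i, x j i ^ 2 ≤ ∑ _j : Fin n, R ^ 2 := Finset.sum_le_sum fun j _ => by
          have := pow_le_pow_left₀ (norm_nonneg _) (hx j) 2
          rwa [EuclideanSpace.norm_sq_eq, Finset.sum_congr rfl fun i _ => by
            rw [Real.norm_eq_abs, sq_abs]] at this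
      _ = n * R ^ 2 := by simp
  exact (Finset.expect_le_expect fun τ _ => h1 τ).trans (Real.le_sqrt_of_sq_le (h2.trans h3))

/-- The Rademacher average of softmax policies on a sample. -/
lemma expect_iSup_actionProb_le {T S A : Type*} [Finite T] [Nonempty T] [Fintype A] {n d : ℕ}
    {R : ℝ} {φ : S → EuclideanSpace ℝ (Fin d)} (hφ : ∀ s, ‖φ s‖ ≤ R)
    (W : T → Matrix A (Fin d) ℝ) (hW : ∀ t, W t ∈ FrobeniusBall A d) (x : Fin n → S × A) :
    𝔼 σ : Fin n → Bool, ⨆ t, ∑ j, sgn (σ j) * actionProb φ (W t) (x j).1 (x j).2 ≤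
      4 * Real.sqrt (Fintype.card A * n * R ^ 2) := by
  classical
  have h := expect_iSup_signSum_le (L := 2) zero_le_two n 0
    (fun j t => actionProb φ (W t) (x j).1 (x j).2)
    (fun j t => (W t).mulVec (φ (x j).1).ofLp)
    fun j t t' => abs_actionProb_sub_le φ (W t) (W t') (x j).1 (x j).2
  have h2 := expect_iSup_mulVec_le W hW (fun j => φ (x j).1) fun j => hφ _
  simp only [Pi.zero_apply, zero_add, ← Real.mul_iSup_of_nonneg (show (0 : ℝ) ≤ 2 * 2 by norm_num),
    ← Finset.mul_expect] at h
  linarith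

end Rademacher

/-! ### Symmetrization and generalization -/

section Generalization

open scoped BigOperators

/-- Exchange the two entries of the pairs at the coordinates marked `false`. -/
def swapPairs {Z : Type*} {n : ℕ} (σ : Fin n → Bool) (w : Fin n → Z × Z) : Fin n → Z × Z :=
  fun j => if σ j then w j else (w j).swap

lemma measurePreserving_swapPairs {Z : Type*} [MeasurableSpace Z] {n : ℕ} (ν : Measure Z)
    [IsProbabilityMeasure ν] (σ : Fin n → Bool) :
    MeasurePreserving (swapPairs σ) (Measure.pi fun _ : Fin n => ν.prod ν)
      (Measure.pi fun _ => ν.prod ν) := by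
  refine measurePreserving_pi (f := fun j (p : Z × Z) => if σ j then p else p.swap) _ _ fun j => ?_
  cases σ j
  · simpa using Measure.measurePreserving_swap
  · exact MeasurePreserving.id _

lemma measurable_swapPairs {Z : Type*} [MeasurableSpace Z] {n : ℕ} (σ : Fin n → Bool) :
    Measurable (swapPairs σ : (Fin n → Z × Z) → _) := by
  refine measurable_pi_lambda _ fun j => ?_
  simp only [swapPairs]
  split_ifs <;> fun_prop

lemma integrable_of_measurable_of_abs_le {Ω : Type*} [MeasurableSpace Ω] {P : Measure Ω}
    [IsFiniteMeasure P] {f : Ω → ℝ} (hf : Measurable f) {C : ℝ} (hC : ∀ ω, |f ω| ≤ C) :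
    Integrable f P :=
  Integrable.of_bound hf.aestronglyMeasurable C (Filter.Eventually.of_forall hC)

/-- Symmetrization, for a function that is chosen depending on the sample. -/
lemma integral_sum_sub_le_of_symmetrized {Z : Type*} [MeasurableSpace Z] (ν : Measure Z)
    [IsProbabilityMeasure ν] {n : ℕ} {F : (Fin n → Z) → Z → ℝ}
    (hF : Measurable fun p : (Fin n → Z) × Z => F p.1 p.2) {C : ℝ} (hC : ∀ x z, |F x z| ≤ C)
    {B : ℝ} (hB : ∀ w : Fin n → Z × Z,
      𝔼 σ : Fin n → Bool, ∑ j, sgn (σ j) * (F (fun i => (swapPairs σ w i).1) (w j).1 -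
        F (fun i => (swapPairs σ w i).1) (w j).2) ≤ B) :
    ∫ x, ∑ j, F x (x j) ∂(Measure.pi fun _ => ν) -
      n * ∫ x, ∫ z, F x z ∂ν ∂(Measure.pi fun _ : Fin n => ν) ≤ B := by
  set P := Measure.pi fun _ : Fin n => ν.prod ν
  set N := Measure.pi fun _ : Fin n => ν
  have hfst : MeasurePreserving (fun (w : Fin n → Z × Z) i => (w i).1) P N :=
    measurePreserving_pi _ _ fun _ => measurePreserving_fst
  have hpair : ∀ j, MeasurePreserving
      (fun w : Fin n → Z × Z => ((fun i => (w i).1), (w j).2)) P (N.prod ν) := fun j =>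
    ((MeasurePreserving.id N).prod (measurePreserving_eval (fun _ : Fin n => ν) j)).comp
      (measurePreserving_arrowProdEquivProdArrow Z Z (Fin n) (fun _ => ν) fun _ => ν)
  have hm1 : ∀ j, Measurable fun w : Fin n → Z × Z => F (fun i => (w i).1) (w j).1 := fun j =>
    hF.comp (f := fun w : Fin n → Z × Z => ((fun i => (w i).1), (w j).1)) (by fun_prop)
  have hm2 : ∀ j, Measurable fun w : Fin n → Z × Z => F (fun i => (w i).1) (w j).2 := fun j =>
    hF.comp (f := fun w : Fin n → Z × Z => ((fun i => (w i).1), (w j).2)) (by fun_prop)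
  have hi1 : ∀ j, Integrable (fun w : Fin n → Z × Z => F (fun i => (w i).1) (w j).1) P :=
    fun j => integrable_of_measurable_of_abs_le (hm1 j) fun _ => hC _ _
  have hi2 : ∀ j, Integrable (fun w : Fin n → Z × Z => F (fun i => (w i).1) (w j).2) P :=
    fun j => integrable_of_measurable_of_abs_le (hm2 j) fun _ => hC _ _
  set G : (Fin n → Z × Z) → ℝ := fun w =>
    ∑ j, (F (fun i => (w i).1) (w j).1 - F (fun i => (w i).1) (w j).2)
  have hGi : Integrable G P := integrable_finsetSum _ fun j _ => (hi1 j).sub (hi2 j)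
  have e1 : ∫ w, G w ∂P = ∫ x, ∑ j, F x (x j) ∂N - n * ∫ x, ∫ z, F x z ∂ν ∂N := by
    have a1 : ∫ x, ∑ j, F x (x j) ∂N = ∑ j, ∫ w, F (fun i => (w i).1) (w j).1 ∂P := by
      rw [← integral_finsetSum _ fun j _ => hi1 j, ← hfst.map_eq, integral_map]
      · exact hfst.measurable.aemeasurable
      · exact (Finset.measurable_sum _ fun j _ =>
          hF.comp (f := fun x : Fin n → Z => (x, x j)) (by fun_prop)).aestronglyMeasurable
    have a2 : ∀ j, ∫ w, F (fun i => (w i).1) (w j).2 ∂P = ∫ x, ∫ z, F x z ∂ν ∂N := fun j => by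
      have h1 : Integrable (fun p : (Fin n → Z) × Z => F p.1 p.2) (N.prod ν) :=
        integrable_of_measurable_of_abs_le hF fun _ => hC _ _
      rw [← integral_prod _ h1, ← (hpair j).map_eq, integral_map]
      · exact (hpair j).measurable.aemeasurable
      · exact hF.aestronglyMeasurable
    have a3 : ∫ w, G w ∂P = ∑ j, ∫ w, (F (fun i => (w i).1) (w j).1 -
        F (fun i => (w i).1) (w j).2) ∂P := integral_finsetSum _ fun j _ => (hi1 j).sub (hi2 j)
    rw [a1, a3]
    simp only [integral_sub (hi1 _) (hi2 _), a2, Finset.sum_sub_distrib, Finset.sum_const,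
      Finset.card_univ, Fintype.card_fin, nsmul_eq_mul]
  have e2 : ∀ σ, ∫ w, G (swapPairs σ w) ∂P = ∫ w, G w ∂P := fun σ => by
    have h : P.map (swapPairs σ) = P := (measurePreserving_swapPairs ν σ).map_eq
    have h2 := integral_map (f := G) (μ := P) (measurable_swapPairs σ).aemeasurable
      (by rw [h]; exact hGi.aestronglyMeasurable)
    rw [h] at h2
    exact h2.symm
  have hGs : ∀ σ, Integrable (fun w => G (swapPairs σ w)) P := fun σ =>
    (measurePreserving_swapPairs ν σ).integrable_comp_of_integrable hGi
  -- Swapping a pair flips the sign of its difference, but the function is now selected from the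
  -- swapped sample and so still depends on σ.
  have e3 : ∀ σ w, G (swapPairs σ w) =
      ∑ j, sgn (σ j) * (F (fun i => (swapPairs σ w i).1) (w j).1 -
        F (fun i => (swapPairs σ w i).1) (w j).2) := fun σ w => by
    refine Finset.sum_congr rfl fun j _ => ?_
    have h : ∀ f : Z → ℝ, f (swapPairs σ w j).1 - f (swapPairs σ w j).2 =
        sgn (σ j) * (f (w j).1 - f (w j).2) := fun f => by
      cases h : σ j <;> simp [swapPairs, h, sgn]
    exact h (F fun i => (swapPairs σ w i).1)
  rw [← e1]
  calc ∫ w, G w ∂P = 𝔼 σ : Fin n → Bool, ∫ w, G (swapPairs σ w) ∂P := by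
        simp only [e2, Fintype.expect_const]
    _ = ∫ w, 𝔼 σ : Fin n → Bool, G (swapPairs σ w) ∂P := by
        simp only [Fintype.expect_eq_sum_div_card]
        rw [integral_div, integral_finsetSum _ fun σ _ => hGs σ]
    _ ≤ ∫ _w, B ∂P := by
        refine integral_mono ?_ (integrable_const _) fun w => ?_
        · simp only [Fintype.expect_eq_sum_div_card]
          exact (integrable_finsetSum _ fun σ _ => hGs σ).div_const _
        · simpa only [e3] using hB w
    _ = B := by simp

variable {S A : Type*} [MeasurableSpace S] [Fintype A] [MeasurableSpace A]
  [MeasurableSingletonClass A] {d : ℕ}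

lemma measurable_actionProb_uncurry {X : Type*} [MeasurableSpace X] (φ : Representation S d)
    {W : X → Matrix A (Fin d) ℝ} (hW : ∀ a j, Measurable fun x => W x a j) :
    Measurable fun p : X × (S × A) => actionProb φ.1 (W p.1) p.2.1 p.2.2 := by
  have h : Measurable fun q : (X × S) × A => actionProb φ.1 (W q.1.1) q.1.2 q.2 := by
    refine measurable_from_prod_countable_left fun a => ?_
    have hφ := φ.2
    have hv : ∀ b, Measurable fun q : X × S => (W q.1).mulVec (φ.1 q.2).ofLp b := fun b => by
      simp only [Matrix.mulVec, dotProduct]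
      refine Finset.measurable_sum _ fun j _ => ((hW b j).comp measurable_fst).mul ?_
      fun_prop
    simp only [actionProb, softmax]
    fun_prop
  exact h.comp (f := fun p : X × (S × A) => ((p.1, p.2.1), p.2.2)) (by fun_prop)

/-- Generalization of a softmax policy whose parameter depends on the sample. -/
lemma integral_sum_actionProb_sub_le (φ : Representation S d) {R : ℝ} (hφ : ∀ s, ‖φ.1 s‖ ≤ R)
    {n : ℕ} {W : (Fin n → S × A) → Matrix A (Fin d) ℝ} (hW : ∀ x, W x ∈ FrobeniusBall A d)
    (hWm : ∀ a j, Measurable fun x => W x a j) (ν : Measure (S × A)) [IsProbabilityMeasure ν] :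
    ∫ x, ∑ j, actionProb φ.1 (W x) (x j).1 (x j).2 ∂(Measure.pi fun _ => ν) -
      n * ∫ x, ∫ z, actionProb φ.1 (W x) z.1 z.2 ∂ν ∂(Measure.pi fun _ : Fin n => ν) ≤
      8 * Real.sqrt (Fintype.card A * n * R ^ 2) := by
  refine integral_sum_sub_le_of_symmetrized ν (F := fun x z => actionProb φ.1 (W x) z.1 z.2)
    (measurable_actionProb_uncurry φ hWm) (C := 1)
    (fun x z => abs_le.2 ⟨by linarith [actionProb_pos φ.1 (W x) z.1 z.2],
      actionProb_le_one _ _ _ _⟩) fun w => ?_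
  -- For fixed w only finitely many parameters are ever selected, one per σ. The supremum over this
  -- finite family dominates the selection, so no supremum over the whole ball is needed.
  set V : (Fin n → Bool) → Matrix A (Fin d) ℝ := fun σ => W fun i => (swapPairs σ w i).1
  have hV : ∀ σ, V σ ∈ FrobeniusBall A d := fun σ => hW _
  have h1 := expect_iSup_actionProb_le hφ V hV fun j => (w j).1
  have h2 := expect_iSup_actionProb_le hφ V hV fun j => (w j).2
  rw [← expect_not] at h2
  refine le_trans ?_ ((add_le_add h1 h2).trans_eq (by ring))
  rw [← Finset.expect_add_distrib]
  refine Finset.expect_le_expect fun σ _ => ?_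
  have b1 := le_ciSup (f := fun t => ∑ j, sgn (σ j) * actionProb φ.1 (V t) (w j).1.1 (w j).1.2)
    (Set.finite_range _).bddAbove σ
  have b2 := le_ciSup (f := fun t => ∑ j, sgn (!σ j) * actionProb φ.1 (V t) (w j).2.1 (w j).2.2)
    (Set.finite_range _).bddAbove σ
  refine le_trans (le_of_eq ?_) (add_le_add b1 b2)
  rw [← Finset.sum_add_distrib]
  refine Finset.sum_congr rfl fun j _ => ?_
  rw [sgn_not]
  ring

end Generalization

/-! ### Rollouts and behaviour cloning -/

namespace TaskFamily

section Rollout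

variable {Θ S A : Type*} [MeasurableSpace Θ] [MeasurableSpace S] [MeasurableSpace A]
  (𝓜 : TaskFamily Θ S A)

lemma lintegral_rollout_succ (π : Kernel (Θ × S) A) [IsMarkovKernel π] (m : ℕ) (θ : Θ) (s : S)
    {f : (Fin (m + 1) → S × A) → ℝ≥0∞} (hf : Measurable f) :
    ∫⁻ τ, f τ ∂(𝓜.rollout π (m + 1) (θ, s)) =
      ∫⁻ a, ∫⁻ s', ∫⁻ τ, f (Fin.cons (s, a) τ) ∂(𝓜.rollout π m (θ, s'))
        ∂(𝓜.trans ((θ, s), a)) ∂(π (θ, s)) := by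
  have hc := measurable_consStep (Θ := Θ) (S := S) (A := A) m
  have hfc : Measurable fun y : (Θ × S) × ((A × S) × (Fin m → S × A)) =>
      f (Fin.cons (y.1.2, y.2.1.1) y.2.2) := hf.comp hc
  have hfs : Measurable fun b : (A × S) × (Fin m → S × A) => f (Fin.cons (s, b.1.1) b.2) :=
    hfc.comp (measurable_prodMk_left (x := (θ, s)))
  rw [rollout, Kernel.lintegral_map _ hc _ hf, Kernel.lintegral_id_prod hfc]
  refine (Kernel.lintegral_compProd _ _ _ hfs).trans ?_
  rw [Kernel.lintegral_compProd]
  · rfl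
  · exact (Measurable.lintegral_kernel_prod_right'
      (κ := (𝓜.rollout π m).comap (fun p : (Θ × S) × (A × S) => (p.1.1, p.2.2)) (by fun_prop))
      (f := fun q => f (Fin.cons (q.1.1.2, q.1.2.1) q.2))
      (hfc.comp (f := fun q : ((Θ × S) × (A × S)) × (Fin m → S × A) => (q.1.1, q.1.2, q.2))
        (by fun_prop))).comp (measurable_prodMk_left (x := (θ, s)))

/-- The expected sum of `g` along `m` steps of `π` in task `θ`, starting at `s`. -/
noncomputable def total (g : S × A → ℝ≥0∞) (π : Kernel (Θ × S) A) (m : ℕ) (θ : Θ) (s : S) : ℝ≥0∞ :=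
  ∫⁻ τ, ∑ i, g (τ i) ∂(𝓜.rollout π m (θ, s))

lemma measurable_total {g : Θ → S × A → ℝ≥0∞} (hg : Measurable fun p : Θ × (S × A) => g p.1 p.2)
    (π : Kernel (Θ × S) A) [IsMarkovKernel π] (m : ℕ) :
    Measurable fun p : Θ × S => 𝓜.total (g p.1) π m p.1 p.2 := by
  unfold total
  refine Measurable.lintegral_kernel_prod_right (κ := 𝓜.rollout π m)
    (f := fun p τ => ∑ i, g p.1 (τ i)) ?_
  refine Finset.measurable_sum _ fun i _ => ?_
  exact hg.comp (f := fun q : (Θ × S) × (Fin m → S × A) => (q.1.1, q.2 i)) (by fun_prop)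

lemma measurable_total_right {g : S × A → ℝ≥0∞} (hg : Measurable g) (π : Kernel (Θ × S) A)
    [IsMarkovKernel π] (m : ℕ) (θ : Θ) : Measurable (𝓜.total g π m θ) :=
  (𝓜.measurable_total (g := fun _ => g) (hg.comp measurable_snd) π m).comp measurable_prodMk_left

lemma total_zero (g : S × A → ℝ≥0∞) (π : Kernel (Θ × S) A) (θ : Θ) (s : S) :
    𝓜.total g π 0 θ s = 0 := by
  simp [total]

/-- The Bellman recursion, which drives the behaviour cloning induction. -/
lemma total_succ {g : S × A → ℝ≥0∞} (hg : Measurable g) (π : Kernel (Θ × S) A) [IsMarkovKernel π]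
    (m : ℕ) (θ : Θ) (s : S) :
    𝓜.total g π (m + 1) θ s =
      ∫⁻ a, (g (s, a) + ∫⁻ s', 𝓜.total g π m θ s' ∂(𝓜.trans ((θ, s), a))) ∂(π (θ, s)) := by
  rw [total, lintegral_rollout_succ]
  · refine lintegral_congr fun a => ?_
    simp only [Fin.sum_univ_succ, Fin.cons_zero, Fin.cons_succ]
    have h : ∀ s', ∫⁻ τ, (g (s, a) + ∑ i, g (τ i)) ∂(𝓜.rollout π m (θ, s')) =
        g (s, a) + 𝓜.total g π m θ s' := fun s' => by
      rw [lintegral_add_left measurable_const, lintegral_const, measure_univ, mul_one, total]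
    simp only [h]
    rw [lintegral_add_left measurable_const, lintegral_const, measure_univ, mul_one]
  · fun_prop

lemma total_le {g : S × A → ℝ≥0∞} (hg : ∀ z, g z ≤ 1) (π : Kernel (Θ × S) A) [IsMarkovKernel π]
    (m : ℕ) (θ : Θ) (s : S) : 𝓜.total g π m θ s ≤ m := by
  calc 𝓜.total g π m θ s ≤ ∫⁻ _, (m : ℝ≥0∞) ∂(𝓜.rollout π m (θ, s)) :=
        lintegral_mono fun τ => (Finset.sum_le_sum fun i _ => hg (τ i)).trans_eq (by simp)
    _ = m := by simp

/-- Behaviour cloning: the cost of a policy against the cost of a deterministic expert that also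
pays `H` for every disagreement. -/
lemma total_le_total_expert [MeasurableSingletonClass A] {θ : Θ} (hdet : 𝓜.DeterministicExpert θ)
    (q : Kernel (Θ × S) A) [IsMarkovKernel q] {c e : S × A → ℝ≥0∞} (hc : Measurable c)
    (hc1 : ∀ z, c z ≤ 1) (he : Measurable e)
    (hqe : ∀ s a, 𝓜.expert (θ, s) = Measure.dirac a → q (θ, s) {a}ᶜ ≤ e (s, a)) {H m : ℕ}
    (hm : m ≤ H) (s : S) :
    𝓜.total c q m θ s ≤ 𝓜.total (fun z => c z + H * e z) 𝓜.expert m θ s := by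
  induction m generalizing s with
  | zero => simp [total_zero]
  | succ m ih =>
    obtain ⟨a, ha⟩ := hdet s
    rw [total_succ _ hc, total_succ _ (by fun_prop), ha, lintegral_dirac]
    -- Whatever action is taken, the remaining cost is at most m + 1 ≤ H; this is the price of one
    -- disagreement.
    have hG : ∀ b, c (s, b) + ∫⁻ s', 𝓜.total c q m θ s' ∂(𝓜.trans ((θ, s), b)) ≤ H := fun b => by
      calc c (s, b) + ∫⁻ s', 𝓜.total c q m θ s' ∂(𝓜.trans ((θ, s), b))
          ≤ 1 + ∫⁻ _, (m : ℝ≥0∞) ∂(𝓜.trans ((θ, s), b)) :=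
            add_le_add (hc1 _) (lintegral_mono fun s' => 𝓜.total_le hc1 q m θ s')
        _ = ((m + 1 : ℕ) : ℝ≥0∞) := by simp [add_comm]
        _ ≤ H := by exact_mod_cast hm
    -- On agreement the induction hypothesis applies at the next state, which has the expert's law;
    -- on the complement everything still to come is charged H.
    rw [← lintegral_add_compl _ (measurableSet_singleton a), lintegral_singleton]
    calc _ ≤ (c (s, a) + ∫⁻ s', 𝓜.total c q m θ s' ∂(𝓜.trans ((θ, s), a))) * 1 +
            ∫⁻ _ in {a}ᶜ, (H : ℝ≥0∞) ∂(q (θ, s)) :=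
          add_le_add (mul_le_mul_right prob_le_one _) (lintegral_mono fun b => hG b)
      _ ≤ (c (s, a) + ∫⁻ s', 𝓜.total (fun z => c z + H * e z) 𝓜.expert m θ s'
            ∂(𝓜.trans ((θ, s), a))) + H * e (s, a) := by
          rw [mul_one, setLIntegral_const]
          exact add_le_add (add_le_add le_rfl (lintegral_mono fun s' => ih (by omega) s'))
            (mul_le_mul_right (hqe s a ha) _)
      _ = _ := by ring

lemma total_add_const_mul {c e : S × A → ℝ≥0∞} (hc : Measurable c) (he : Measurable e) (k : ℝ≥0∞)
    (π : Kernel (Θ × S) A) (m : ℕ) (θ : Θ) (s : S) :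
    𝓜.total (fun z => c z + k * e z) π m θ s = 𝓜.total c π m θ s + k * 𝓜.total e π m θ s := by
  simp only [total, Finset.sum_add_distrib, ← Finset.mul_sum]
  rw [lintegral_add_left (by fun_prop), lintegral_const_mul _ (by fun_prop)]

/-- Along a rollout the action is drawn from the policy at the current state. -/
lemma lintegral_rollout_apply (π : Kernel (Θ × S) A) [IsMarkovKernel π] {g : S × A → ℝ≥0∞}
    (hg : Measurable g) (θ : Θ) {m : ℕ} (h : Fin m) (s : S) :
    ∫⁻ τ, g (τ h) ∂(𝓜.rollout π m (θ, s)) =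
      ∫⁻ τ, ∫⁻ a, g ((τ h).1, a) ∂(π (θ, (τ h).1)) ∂(𝓜.rollout π m (θ, s)) := by
  have hg' : Measurable fun s => ∫⁻ a, g (s, a) ∂(π (θ, s)) :=
    (Measurable.lintegral_kernel_prod_right (κ := π) (f := fun p a => g (p.2, a))
      (by unfold Function.uncurry; fun_prop)).comp measurable_prodMk_left
  induction m generalizing s with
  | zero => exact h.elim0
  | succ m ih =>
    have hg'' : Measurable fun τ : Fin (m + 1) → S × A => ∫⁻ a, g ((τ h).1, a) ∂(π (θ, (τ h).1)) :=
      hg'.comp (by fun_prop)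
    rw [lintegral_rollout_succ _ _ _ _ _ (by fun_prop), lintegral_rollout_succ _ _ _ _ _ hg'']
    refine Fin.cases ?_ (fun j => ?_) h
    · simp
    · simp only [Fin.cons_succ, ih]

lemma lintegral_trajectory (H : ℕ) (π : Kernel (Θ × S) A) [IsMarkovKernel π] (θ : Θ)
    {f : (Fin H → S × A) → ℝ≥0∞} (hf : Measurable f) :
    ∫⁻ τ, f τ ∂(𝓜.trajectory H π θ) =
      ∫⁻ s, ∫⁻ τ, f τ ∂(𝓜.rollout π H (θ, s)) ∂(𝓜.init θ) := by
  rw [trajectory, Kernel.lintegral_snd _ _ hf, Kernel.lintegral_compProd _ _ _ (by fun_prop)]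

/-- At each level the expert's action is drawn from the expert policy at the current state, so the
level's state-action pair has the law used in the average. This converts disagreements accumulated
along expert trajectories into an expectation over demonstrations. -/
lemma lintegral_demo (H : ℕ) [NeZero H] (θ : Θ) {g : S × A → ℝ≥0∞} (hg : Measurable g) :
    H * ∫⁻ z, g z ∂(𝓜.demo H θ) = ∫⁻ s, 𝓜.total g 𝓜.expert H θ s ∂(𝓜.init θ) := by
  have hg' : Measurable fun s => ∫⁻ a, g (s, a) ∂(𝓜.expert (θ, s)) :=
    (Measurable.lintegral_kernel_prod_right (κ := 𝓜.expert) (f := fun p a => g (p.2, a))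
      (by unfold Function.uncurry; fun_prop)).comp measurable_prodMk_left
  have h1 : ∫⁻ z, g z ∂(𝓜.demo H θ) =
      ∫⁻ s, ∫⁻ a, g (s, a) ∂(𝓜.expert (θ, s)) ∂(𝓜.avgStateDist H 𝓜.expert θ) := by
    rw [demo, Kernel.lintegral_compProd _ _ _ hg]
  have h2 : 𝓜.avgStateDist H 𝓜.expert θ =
      (H : ℝ≥0∞)⁻¹ • ∑ h : Fin H, 𝓜.stateDist H 𝓜.expert h θ := rfl
  have hH : (H : ℝ≥0∞) * (H : ℝ≥0∞)⁻¹ = 1 :=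
    ENNReal.mul_inv_cancel (by simpa using NeZero.ne H) (ENNReal.natCast_ne_top H)
  rw [h1, h2, lintegral_smul_measure, smul_eq_mul, ← mul_assoc, hH, one_mul,
    lintegral_finsetSum_measure]
  have h3 : ∀ h : Fin H, ∫⁻ s, ∫⁻ a, g (s, a) ∂(𝓜.expert (θ, s)) ∂(𝓜.stateDist H 𝓜.expert h θ) =
      ∫⁻ s, ∫⁻ τ, g (τ h) ∂(𝓜.rollout 𝓜.expert H (θ, s)) ∂(𝓜.init θ) := fun h => by
    rw [stateDist, Kernel.lintegral_map _ (by fun_prop) _ hg', lintegral_trajectory]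
    · exact lintegral_congr fun s => (𝓜.lintegral_rollout_apply _ hg θ h s).symm
    · exact hg'.comp (by fun_prop)
  simp only [h3]
  rw [← lintegral_finsetSum]
  · refine lintegral_congr fun s => ?_
    rw [total, lintegral_finsetSum]
    fun_prop
  · intro h _
    exact (Measurable.lintegral_kernel_prod_right (κ := 𝓜.rollout 𝓜.expert H)
      (f := fun _ τ => g (τ h)) (by unfold Function.uncurry; fun_prop)).comp measurable_prodMk_left

/-- The cost function with values in `ℝ≥0∞`. -/
noncomputable def ecost (θ : Θ) (z : S × A) : ℝ≥0∞ := ENNReal.ofReal (𝓜.cost θ z.1 z.2)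

lemma measurable_ecost_uncurry : Measurable fun p : Θ × (S × A) => 𝓜.ecost p.1 p.2 :=
  (𝓜.cost_measurable.comp
    (f := fun p : Θ × (S × A) => ((p.1, p.2.1), p.2.2)) (by fun_prop)).ennreal_ofReal

lemma measurable_ecost (θ : Θ) : Measurable (𝓜.ecost θ) :=
  𝓜.measurable_ecost_uncurry.comp measurable_prodMk_left

lemma ecost_le_one (θ : Θ) (z : S × A) : 𝓜.ecost θ z ≤ 1 :=
  ENNReal.ofReal_le_one.2 (𝓜.cost_le_one θ _ _)

lemma value_eq_toReal_total (π : Kernel (Θ × S) A) (m : ℕ) (θ : Θ) (s : S) :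
    𝓜.value π m θ s = (𝓜.total (𝓜.ecost θ) π m θ s).toReal := by
  have hm : Measurable fun z : S × A => 𝓜.cost θ z.1 z.2 :=
    𝓜.cost_measurable.comp (f := fun z : S × A => ((θ, z.1), z.2)) (by fun_prop)
  rw [value, total, integral_eq_lintegral_of_nonneg_ae]
  · congr 1
    refine lintegral_congr fun τ => ?_
    exact ENNReal.ofReal_sum_of_nonneg fun i _ => 𝓜.cost_nonneg θ _ _
  · exact Filter.Eventually.of_forall fun τ => Finset.sum_nonneg fun i _ => 𝓜.cost_nonneg θ _ _
  · refine (Finset.measurable_sum _ fun i _ => ?_).aestronglyMeasurable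
    exact hm.comp (measurable_pi_apply i)

lemma lintegral_total_ecost_le (H : ℕ) (π : Kernel (Θ × S) A) [IsMarkovKernel π] (θ : Θ) :
    ∫⁻ s, 𝓜.total (𝓜.ecost θ) π H θ s ∂(𝓜.init θ) ≤ H :=
  (lintegral_mono fun s => 𝓜.total_le (𝓜.ecost_le_one θ) π H θ s).trans (by simp)

lemma expectedCost_eq_toReal (H : ℕ) (π : Kernel (Θ × S) A) [IsMarkovKernel π] (θ : Θ) :
    𝓜.expectedCost H π θ = (∫⁻ s, 𝓜.total (𝓜.ecost θ) π H θ s ∂(𝓜.init θ)).toReal := by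
  simp only [expectedCost, value_eq_toReal_total]
  refine integral_toReal (𝓜.measurable_total_right (𝓜.measurable_ecost θ) π H θ).aemeasurable ?_
  exact Filter.Eventually.of_forall fun s =>
    (𝓜.total_le (𝓜.ecost_le_one θ) π H θ s).trans_lt (ENNReal.natCast_lt_top H)

lemma expectedCost_nonneg (H : ℕ) (π : Kernel (Θ × S) A) [IsMarkovKernel π] (θ : Θ) :
    0 ≤ 𝓜.expectedCost H π θ := by
  rw [expectedCost_eq_toReal]; exact ENNReal.toReal_nonneg

lemma expectedCost_le (H : ℕ) (π : Kernel (Θ × S) A) [IsMarkovKernel π] (θ : Θ) :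
    𝓜.expectedCost H π θ ≤ H := by
  rw [expectedCost_eq_toReal]
  exact ENNReal.toReal_le_of_le_ofReal (Nat.cast_nonneg _)
    (by simpa using 𝓜.lintegral_total_ecost_le H π θ)

lemma measurable_expectedCost (H : ℕ) (π : Kernel (Θ × S) A) [IsMarkovKernel π] :
    Measurable (𝓜.expectedCost H π) := by
  have h : Measurable fun θ => ∫⁻ s, 𝓜.total (𝓜.ecost θ) π H θ s ∂(𝓜.init θ) :=
    Measurable.lintegral_kernel_prod_right (κ := 𝓜.init)
      (f := fun θ s => 𝓜.total (𝓜.ecost θ) π H θ s)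
      (𝓜.measurable_total 𝓜.measurable_ecost_uncurry π H)
  have e : 𝓜.expectedCost H π =
      fun θ => (∫⁻ s, 𝓜.total (𝓜.ecost θ) π H θ s ∂(𝓜.init θ)).toReal :=
    funext fun θ => 𝓜.expectedCost_eq_toReal H π θ
  rw [e]
  exact h.ennreal_toReal

variable [Fintype A] [MeasurableSingletonClass A]

lemma _root_.ImitationLearning.softmaxPolicy_singleton {d : ℕ} (φ : Representation S d)
    (W : Matrix A (Fin d) ℝ) (s : S) (a : A) :
    softmaxPolicy φ W s {a} = ENNReal.ofReal (actionProb φ.1 W s a) := by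
  classical
  change (∑ b, ENNReal.ofReal (actionProb φ.1 W s b) • Measure.dirac b) {a} = _
  simp [Measure.finsetSum_apply, Set.indicator_apply]

/-- The excess cost of a softmax policy is controlled by its disagreement with the expert on the
distribution of demonstrations. -/
lemma expectedCost_softmaxPolicy_le [Nonempty A] (H : ℕ) [NeZero H] {d : ℕ}
    (φ : Representation S d) (W : Matrix A (Fin d) ℝ) {θ : Θ} (hdet : 𝓜.DeterministicExpert θ) :
    𝓜.expectedCost H (Kernel.prodMkLeft Θ (softmaxPolicy φ W)) θ ≤
      𝓜.expectedCost H 𝓜.expert θ +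
        H ^ 2 * (1 - ∫ z, actionProb φ.1 W z.1 z.2 ∂(𝓜.demo H θ)) := by
  set q := Kernel.prodMkLeft Θ (softmaxPolicy φ W)
  have hpm : Measurable fun z : S × A => actionProb φ.1 W z.1 z.2 :=
    (measurable_actionProb_uncurry (X := Unit) φ (W := fun _ => W)
      fun _ _ => measurable_const).comp (measurable_prodMk_left (x := ()))
  set e : S × A → ℝ≥0∞ := fun z => ENNReal.ofReal (1 - actionProb φ.1 W z.1 z.2)
  have he : Measurable e := (measurable_const.sub hpm).ennreal_ofReal
  have hqe : ∀ s a, 𝓜.expert (θ, s) = Measure.dirac a → q (θ, s) {a}ᶜ ≤ e (s, a) :=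
    fun s a _ => by
      rw [prob_compl_eq_one_sub (measurableSet_singleton a)]
      change 1 - softmaxPolicy φ W s {a} ≤ _
      rw [softmaxPolicy_singleton, ← ENNReal.ofReal_one,
        ← ENNReal.ofReal_sub _ (actionProb_pos _ _ _ _).le]
  -- One factor H is the price of a disagreement, the other undoes the averaging over the H levels.
  have key : ∫⁻ s, 𝓜.total (𝓜.ecost θ) q H θ s ∂(𝓜.init θ) ≤
      ∫⁻ s, 𝓜.total (𝓜.ecost θ) 𝓜.expert H θ s ∂(𝓜.init θ) +
        H * (H * ∫⁻ z, e z ∂(𝓜.demo H θ)) := by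
    rw [lintegral_demo _ _ _ he, ← lintegral_const_mul _ (𝓜.measurable_total_right he _ _ _),
      ← lintegral_add_left (𝓜.measurable_total_right (𝓜.measurable_ecost θ) _ _ _)]
    refine lintegral_mono fun s => ?_
    rw [← 𝓜.total_add_const_mul (𝓜.measurable_ecost θ) he]
    exact 𝓜.total_le_total_expert hdet q (𝓜.measurable_ecost θ) (𝓜.ecost_le_one θ) he hqe le_rfl s
  have hp1 : ∀ z : S × A, 0 ≤ 1 - actionProb φ.1 W z.1 z.2 := fun z =>
    sub_nonneg.2 (actionProb_le_one _ _ _ _)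
  have hpi : Integrable (fun z : S × A => actionProb φ.1 W z.1 z.2) (𝓜.demo H θ) :=
    integrable_of_measurable_of_abs_le hpm (C := 1) fun z =>
      abs_le.2 ⟨by linarith [actionProb_pos φ.1 W z.1 z.2], actionProb_le_one _ _ _ _⟩
  have h1 : ∫ z, (1 - actionProb φ.1 W z.1 z.2) ∂(𝓜.demo H θ) =
      1 - ∫ z, actionProb φ.1 W z.1 z.2 ∂(𝓜.demo H θ) := by
    rw [integral_sub (integrable_const _) hpi]
    simp
  have he1 : ∫⁻ z, e z ∂(𝓜.demo H θ) =
      ENNReal.ofReal (1 - ∫ z, actionProb φ.1 W z.1 z.2 ∂(𝓜.demo H θ)) := by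
    rw [← h1]
    exact (ofReal_integral_eq_lintegral_ofReal ((integrable_const 1).sub hpi)
      (Filter.Eventually.of_forall hp1)).symm
  have hnn : 0 ≤ 1 - ∫ z, actionProb φ.1 W z.1 z.2 ∂(𝓜.demo H θ) :=
    h1 ▸ integral_nonneg hp1
  have hfin := (𝓜.lintegral_total_ecost_le H 𝓜.expert θ).trans_lt (ENNReal.natCast_lt_top H)
  rw [expectedCost_eq_toReal, expectedCost_eq_toReal]
  rw [he1] at key
  have h2 : (H : ℝ≥0∞) * (H * ENNReal.ofReal
      (1 - ∫ z, actionProb φ.1 W z.1 z.2 ∂(𝓜.demo H θ))) = ENNReal.ofReal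
        (H ^ 2 * (1 - ∫ z, actionProb φ.1 W z.1 z.2 ∂(𝓜.demo H θ))) := by
    rw [ENNReal.ofReal_mul (by positivity), ← mul_assoc, pow_two,
      ENNReal.ofReal_mul (Nat.cast_nonneg _), ENNReal.ofReal_natCast]
  rw [h2] at key
  have h3 := ENNReal.toReal_mono (ENNReal.add_ne_top.2 ⟨hfin.ne, ENNReal.ofReal_ne_top⟩) key
  rwa [ENNReal.toReal_add hfin.ne ENNReal.ofReal_ne_top,
    ENNReal.toReal_ofReal (by positivity)] at h3

end Rollout

end TaskFamily

/-! ### Empirical losses -/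

section EmpiricalLoss

variable {S A : Type*} [MeasurableSpace S] [Fintype A] {d n : ℕ}

lemma empLoss_nonneg (φ : Representation S d) (W : Matrix A (Fin d) ℝ) (x : Fin n → S × A) :
    0 ≤ empLoss φ W x := by
  refine mul_nonneg (by positivity) (Finset.sum_nonneg fun j _ => neg_nonneg.2 ?_)
  exact Real.log_nonpos (actionProb_pos _ _ _ _).le (actionProb_le_one _ _ _ _)

lemma empLoss_le_of_le_actionProb (hn : n ≠ 0) {φ : Representation S d} {W : Matrix A (Fin d) ℝ}
    {x : Fin n → S × A} {p : ℝ} (hp : 0 < p) (h : ∀ j, p ≤ actionProb φ.1 W (x j).1 (x j).2) :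
    empLoss φ W x ≤ -Real.log p := by
  have hn' : (0 : ℝ) < n := by positivity
  calc empLoss φ W x ≤ (1 / (n : ℝ)) * ∑ _j : Fin n, -Real.log p :=
        mul_le_mul_of_nonneg_left
          (Finset.sum_le_sum fun j _ => neg_le_neg (Real.log_le_log hp (h j))) (by positivity)
    _ = -Real.log p := by
        rw [Finset.sum_const, Finset.card_univ, Fintype.card_fin, nsmul_eq_mul]
        field_simp

/-- The geometric mean is at most the arithmetic mean. This passes from the logarithmic loss to
probabilities in [0, 1]. -/
lemma exp_neg_empLoss_le (hn : n ≠ 0) (φ : Representation S d) (W : Matrix A (Fin d) ℝ)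
    (x : Fin n → S × A) :
    Real.exp (-empLoss φ W x) ≤ (1 / (n : ℝ)) * ∑ j, actionProb φ.1 W (x j).1 (x j).2 := by
  have hn' : (0 : ℝ) < n := by positivity
  have h := convexOn_exp.map_sum_le (t := Finset.univ) (w := fun _ : Fin n => 1 / (n : ℝ))
    (p := fun j => Real.log (actionProb φ.1 W (x j).1 (x j).2)) (fun _ _ => by positivity)
    (by simp [hn'.ne']) fun _ _ => Set.mem_univ _
  simp only [smul_eq_mul, Real.exp_log (actionProb_pos _ _ _ _), ← Finset.mul_sum] at h
  simpa only [empLoss, Finset.sum_neg_distrib, mul_neg, neg_neg] using h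

lemma exp_neg_outerLoss_le {T : ℕ} (hT : T ≠ 0) (φ : Representation S d)
    (X : Fin T → Fin n → S × A) :
    Real.exp (-outerLoss φ X) ≤
      (1 / (T : ℝ)) * ∑ t, Real.exp (-⨅ W : FrobeniusBall A d, empLoss φ W.1 (X t)) := by
  have hT' : (0 : ℝ) < T := by positivity
  have h := convexOn_exp.map_sum_le (t := Finset.univ) (w := fun _ : Fin T => 1 / (T : ℝ))
    (p := fun t => -⨅ W : FrobeniusBall A d, empLoss φ W.1 (X t)) (fun _ _ => by positivity)
    (by simp [hT'.ne']) fun _ _ => Set.mem_univ _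
  simpa only [smul_eq_mul, ← Finset.mul_sum, outerLoss, Finset.sum_neg_distrib, mul_neg] using h

variable [MeasurableSpace A] {Φ : Finset (Representation S d)}
  {erm : Representation S d → (Fin n → S × A) → Matrix A (Fin d) ℝ}

lemma IsERM.iInf_empLoss (herm : IsERM Φ erm) {φ : Representation S d} (hφ : φ ∈ Φ)
    (x : Fin n → S × A) : ⨅ W : FrobeniusBall A d, empLoss φ W.1 x = empLoss φ (erm φ x) x := by
  have : Nonempty (FrobeniusBall A d) := ⟨⟨0, zero_mem_frobeniusBall⟩⟩
  refine le_antisymm ?_ (le_ciInf fun W => herm.le φ hφ x W.1 W.2)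
  exact ciInf_le (f := fun W : FrobeniusBall A d => empLoss φ W.1 x)
    ⟨0, by rintro _ ⟨W, rfl⟩; exact empLoss_nonneg _ _ _⟩ ⟨erm φ x, herm.mem φ hφ x⟩

lemma IsERM.measurable_empLoss [MeasurableSingletonClass A] (herm : IsERM Φ erm)
    {φ : Representation S d} (hφ : φ ∈ Φ) : Measurable fun x => empLoss φ (erm φ x) x := by
  have h := measurable_actionProb_uncurry φ (herm.measurable φ hφ)
  refine (Finset.measurable_sum _ fun j _ => ?_).const_mul _
  exact (Real.measurable_log.comp
    (h.comp (f := fun x : Fin n → S × A => (x, x j)) (by fun_prop))).neg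

/-- The minimizer does at least as well as W = 0, the uniform policy. Together with
`IsERM.exp_le_inv_card_add` this confines the exponential to an interval of length min(1, 2R). -/
lemma IsERM.inv_card_le_exp (herm : IsERM Φ erm) (hn : n ≠ 0) {φ : Representation S d}
    (hφ : φ ∈ Φ) (x : Fin n → S × A) :
    (Fintype.card A : ℝ)⁻¹ ≤ Real.exp (-empLoss φ (erm φ x) x) := by
  have hA : 0 < Fintype.card A :=
    Fintype.card_pos_iff.2 ⟨(x ⟨0, Nat.pos_of_ne_zero hn⟩).2⟩
  have hA' : (0 : ℝ) < (Fintype.card A : ℝ)⁻¹ := by positivity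
  have h := (herm.le φ hφ x 0 zero_mem_frobeniusBall).trans
    (empLoss_le_of_le_actionProb hn hA' fun j => (actionProb_zero φ.1 (x j).1 (x j).2).ge)
  rw [← Real.log_le_iff_le_exp hA']
  linarith

lemma IsERM.exp_le_inv_card_add (herm : IsERM Φ erm) (hn : n ≠ 0) {φ : Representation S d}
    (hφ : φ ∈ Φ) {R : ℝ} (hR : ∀ s, ‖φ.1 s‖ ≤ R) (x : Fin n → S × A) :
    Real.exp (-empLoss φ (erm φ x) x) ≤ (Fintype.card A : ℝ)⁻¹ + min 1 (2 * R) := by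
  rw [← min_add_add_left]
  refine le_min ?_ ?_
  · have h1 := Real.exp_le_one_iff.2 (neg_nonpos.2 (empLoss_nonneg φ (erm φ x) x))
    have h2 : (0 : ℝ) ≤ (Fintype.card A : ℝ)⁻¹ := by positivity
    linarith
  · have hn' : (0 : ℝ) < n := by positivity
    refine (exp_neg_empLoss_le hn φ (erm φ x) x).trans ?_
    calc _ ≤ (1 / (n : ℝ)) * ∑ _j : Fin n, ((Fintype.card A : ℝ)⁻¹ + 2 * R) := by
          refine mul_le_mul_of_nonneg_left (Finset.sum_le_sum fun j _ => ?_) (by positivity)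
          have := (abs_le.1 (abs_actionProb_sub_inv_card_le hR (herm.mem φ hφ x) (x j).1
            (x j).2)).2
          linarith
      _ = _ := by
          rw [Finset.sum_const, Finset.card_univ, Fintype.card_fin, nsmul_eq_mul]
          field_simp

end EmpiricalLoss

/-- Hoeffding's inequality for a function with values in an interval of length `r`, applied to
independent samples. -/
lemma measure_pi_average_ge_le {Ω : Type*} [MeasurableSpace Ω] (P : Measure Ω)
    [IsProbabilityMeasure P] {Y : Ω → ℝ} (hY : Measurable Y) {a r : ℝ} (hr : 0 < r)
    (hYa : ∀ ω, a ≤ Y ω) (hYb : ∀ ω, Y ω ≤ a + r) {m t : ℝ} (ht : 0 ≤ t) (hm : ∫ ω, Y ω ∂P ≤ m - t)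
    {T : ℕ} (hT : T ≠ 0) :
    (Measure.pi fun _ : Fin T => P) {X | m ≤ (1 / (T : ℝ)) * ∑ i, Y (X i)} ≤
      ENNReal.ofReal (Real.exp (-(2 * T * t ^ 2 / r ^ 2))) := by
  have hT' : (0 : ℝ) < T := by positivity
  set Q := Measure.pi fun _ : Fin T => P
  set Z : Ω → ℝ := fun ω => Y ω - ∫ ω, Y ω ∂P with hZ
  have hZm : Measurable Z := hY.sub_const _
  have hind : iIndepFun (fun (i : Fin T) (X : Fin T → Ω) => Z (X i)) Q :=
    iIndepFun_pi (X := fun _ => Z) fun _ => hZm.aemeasurable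
  have hsub : ∀ i ∈ (Finset.univ : Finset (Fin T)),
      HasSubgaussianMGF (fun X : Fin T → Ω => Z (X i)) ((‖a + r - a‖₊ / 2) ^ 2) Q := fun i _ => by
    have h := hasSubgaussianMGF_of_mem_Icc (μ := P) (X := Y) (a := a) (b := a + r) hY.aemeasurable
      (Filter.Eventually.of_forall fun ω => ⟨hYa ω, hYb ω⟩)
    have hmp := measurePreserving_eval (fun _ : Fin T => P) i
    rw [← hmp.map_eq] at h
    have h2 := HasSubgaussianMGF.of_map hmp.measurable.aemeasurable h
    rw [hmp.map_eq] at h2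
    exact h2
  -- Each summand has variance proxy (r/2)², so the exponent is -(T t)² / (2 T (r/2)²) = -2 T t² /
  -- r².
  have hH := HasSubgaussianMGF.measure_sum_ge_le_of_iIndepFun hind hsub (ε := T * t) (by positivity)
  have hsubset : {X : Fin T → Ω | m ≤ (1 / (T : ℝ)) * ∑ i, Y (X i)} ⊆
      {X | T * t ≤ ∑ i, Z (X i)} := fun X hX => by
    have hX' : m ≤ (1 / (T : ℝ)) * ∑ i, Y (X i) := hX
    have h1 : (T : ℝ) * m ≤ ∑ i, Y (X i) := by
      have := mul_le_mul_of_nonneg_left hX' hT'.le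
      rwa [← mul_assoc, mul_one_div_cancel hT'.ne', one_mul] at this
    change (T : ℝ) * t ≤ ∑ i, Z (X i)
    simp only [hZ, Finset.sum_sub_distrib, Finset.sum_const, Finset.card_univ, Fintype.card_fin,
      nsmul_eq_mul]
    nlinarith
  refine (measure_mono hsubset).trans ?_
  rw [← ofReal_measureReal]
  refine ENNReal.ofReal_le_ofReal (hH.trans_eq ?_)
  congr 1
  simp only [add_sub_cancel_left, Finset.sum_const, Finset.card_univ, Fintype.card_fin,
    nsmul_eq_mul, NNReal.coe_mul, NNReal.coe_natCast, NNReal.coe_pow, NNReal.coe_div,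
    NNReal.coe_ofNat, coe_nnnorm, Real.norm_eq_abs, abs_of_pos hr]
  field_simp

/-! ### Excess cost of a representation on a new task -/

lemma integral_add_mul_one_sub {Ω : Type*} [MeasurableSpace Ω] {P : Measure Ω}
    [IsProbabilityMeasure P] {f g : Ω → ℝ} (hf : Integrable f P) (hg : Integrable g P) (k : ℝ) :
    ∫ ω, (f ω + k * (1 - g ω)) ∂P = ∫ ω, f ω ∂P + k * (1 - ∫ ω, g ω ∂P) := by
  have h1 : Integrable (fun ω => 1 - g ω) P := (integrable_const _).sub hg
  rw [integral_add hf (h1.const_mul k), integral_const_mul, integral_sub (integrable_const _) hg]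
  simp

namespace TaskFamily

section NewTask

variable {Θ S A : Type*} [MeasurableSpace Θ] [MeasurableSpace S] [MeasurableSpace A]
  (𝓜 : TaskFamily Θ S A)

instance (η : Measure Θ) [IsProbabilityMeasure η] (H n : ℕ) [NeZero H] :
    IsProbabilityMeasure (𝓜.taskDataLaw η H n) :=
  inferInstanceAs (IsProbabilityMeasure (iidKernel n (𝓜.demo H) ∘ₘ η))

lemma integral_taskDataLaw (η : Measure Θ) [IsProbabilityMeasure η] (H n : ℕ) [NeZero H]
    {f : (Fin n → S × A) → ℝ} (hf : Integrable f (𝓜.taskDataLaw η H n)) :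
    ∫ x, f x ∂(𝓜.taskDataLaw η H n) = ∫ θ, ∫ x, f x ∂(iidKernel n (𝓜.demo H) θ) ∂η := by
  have e : 𝓜.taskDataLaw η H n = (iidKernel n (𝓜.demo H) ∘ₖ Kernel.const Unit η) () :=
    Measure.comp_eq_comp_const_apply
  rw [e] at hf ⊢
  rw [Kernel.integral_comp hf, Kernel.const_apply]

lemma nonempty_action (𝓜 : TaskFamily Θ S A) (η : Measure Θ) [IsProbabilityMeasure η] : Nonempty A := by
  obtain ⟨θ⟩ := nonempty_of_isProbabilityMeasure η
  obtain ⟨s⟩ := nonempty_of_isProbabilityMeasure (𝓜.init θ)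
  exact nonempty_of_isProbabilityMeasure (𝓜.expert (θ, s))

variable [Fintype A] {d n : ℕ}

lemma abs_integral_actionProb_le (H : ℕ) [NeZero H] (φ : Representation S d)
    (W : Matrix A (Fin d) ℝ) (θ : Θ) :
    |∫ z, actionProb φ.1 W z.1 z.2 ∂(𝓜.demo H θ)| ≤ 1 := by
  have h := norm_integral_le_of_norm_le_const (μ := 𝓜.demo H θ)
    (f := fun z : S × A => actionProb φ.1 W z.1 z.2) (C := 1) (Filter.Eventually.of_forall fun z => by
      rw [Real.norm_eq_abs, abs_of_pos (actionProb_pos _ _ _ _)]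
      exact actionProb_le_one _ _ _ _)
  simpa using h

/-- The expected probability, on a new demonstration, that the policy learned from `n`
demonstrations of task `θ` agrees with it. -/
noncomputable def agreement (H : ℕ) (φ : Representation S d)
    (W : (Fin n → S × A) → Matrix A (Fin d) ℝ) (θ : Θ) : ℝ :=
  ∫ x, ∫ z, actionProb φ.1 (W x) z.1 z.2 ∂(𝓜.demo H θ) ∂(Measure.pi fun _ => 𝓜.demo H θ)

lemma abs_agreement_le (H : ℕ) [NeZero H] (φ : Representation S d)
    (W : (Fin n → S × A) → Matrix A (Fin d) ℝ) (θ : Θ) : |𝓜.agreement H φ W θ| ≤ 1 := by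
  have h := norm_integral_le_of_norm_le_const (μ := Measure.pi fun _ : Fin n => 𝓜.demo H θ)
    (f := fun x => ∫ z, actionProb φ.1 (W x) z.1 z.2 ∂(𝓜.demo H θ)) (C := 1)
    (Filter.Eventually.of_forall fun x => 𝓜.abs_integral_actionProb_le H φ (W x) θ)
  simpa [agreement] using h

variable [MeasurableSingletonClass A] {Φ : Finset (Representation S d)}
  {erm : Representation S d → (Fin n → S × A) → Matrix A (Fin d) ℝ}

lemma stronglyMeasurable_integral_actionProb (H : ℕ) [NeZero H] {φ : Representation S d}
    {W : (Fin n → S × A) → Matrix A (Fin d) ℝ} (hW : ∀ a j, Measurable fun x => W x a j) :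
    StronglyMeasurable fun p : Θ × (Fin n → S × A) =>
      ∫ z, actionProb φ.1 (W p.2) z.1 z.2 ∂(𝓜.demo H p.1) := by
  refine StronglyMeasurable.integral_kernel_prod_right
    (κ := (𝓜.demo H).comap (Prod.fst : Θ × (Fin n → S × A) → Θ) measurable_fst)
    (f := fun p z => actionProb φ.1 (W p.2) z.1 z.2) ?_
  exact ((measurable_actionProb_uncurry φ hW).comp
    (f := fun q : (Θ × (Fin n → S × A)) × (S × A) => (q.1.2, q.2)) (by fun_prop)).stronglyMeasurable

lemma stronglyMeasurable_agreement (H : ℕ) [NeZero H] {φ : Representation S d}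
    {W : (Fin n → S × A) → Matrix A (Fin d) ℝ} (hW : ∀ a j, Measurable fun x => W x a j) :
    StronglyMeasurable (𝓜.agreement H φ W) :=
  StronglyMeasurable.integral_kernel_prod_right (κ := iidKernel n (𝓜.demo H))
    (f := fun θ x => ∫ z, actionProb φ.1 (W x) z.1 z.2 ∂(𝓜.demo H θ))
    (𝓜.stronglyMeasurable_integral_actionProb H hW)

lemma integrable_agreement (η : Measure Θ) [IsProbabilityMeasure η] (H : ℕ) [NeZero H]
    {φ : Representation S d} {W : (Fin n → S × A) → Matrix A (Fin d) ℝ}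
    (hW : ∀ a j, Measurable fun x => W x a j) : Integrable (𝓜.agreement H φ W) η :=
  integrable_of_measurable_of_abs_le (𝓜.stronglyMeasurable_agreement H hW).measurable
    (𝓜.abs_agreement_le H φ W)

/-- The excess cost on a new task is at most `H ^ 2` times the average disagreement. -/
lemma excessCost_le (η : Measure Θ) [IsProbabilityMeasure η] (H : ℕ) [NeZero H]
    (hdet : ∀ᵐ θ ∂η, 𝓜.DeterministicExpert θ) {φ : Representation S d}
    (hW : ∀ a j, Measurable fun x => erm φ x a j) :
    𝓜.excessCost η H n erm φ ≤ H ^ 2 * (1 - ∫ θ, 𝓜.agreement H φ (erm φ) θ ∂η) := by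
  have : Nonempty A := 𝓜.nonempty_action η
  have hJ : Integrable (𝓜.expectedCost H 𝓜.expert) η :=
    integrable_of_measurable_of_abs_le (𝓜.measurable_expectedCost H _) fun θ =>
      abs_le.2 ⟨by linarith [𝓜.expectedCost_nonneg H 𝓜.expert θ, Nat.cast_nonneg (α := ℝ) H],
        𝓜.expectedCost_le H _ θ⟩
  have hQ := 𝓜.integrable_agreement η H (φ := φ) hW
  have hg : Integrable (fun θ => 𝓜.expectedCost H 𝓜.expert θ +
      (H : ℝ) ^ 2 * (1 - 𝓜.agreement H φ (erm φ) θ)) η :=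
    hJ.add (((integrable_const _).sub hQ).const_mul _)
  have key : ∫ θ, ∫ x, 𝓜.expectedCost H (Kernel.prodMkLeft Θ (softmaxPolicy φ (erm φ x))) θ
      ∂(iidKernel n (𝓜.demo H) θ) ∂η ≤ ∫ θ, (𝓜.expectedCost H 𝓜.expert θ +
        (H : ℝ) ^ 2 * (1 - 𝓜.agreement H φ (erm φ) θ)) ∂η := by
    -- Costs are nonnegative, so only the right-hand side has to be integrable; measurability of the
    -- left integrand in the task and the dataset is not needed.
    refine integral_mono_of_nonneg (Filter.Eventually.of_forall fun θ =>
      integral_nonneg fun x => 𝓜.expectedCost_nonneg H _ θ) hg ?_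
    filter_upwards [hdet] with θ hθ
    have hx : Integrable (fun x => ∫ z, actionProb φ.1 (erm φ x) z.1 z.2 ∂(𝓜.demo H θ))
        (Measure.pi fun _ : Fin n => 𝓜.demo H θ) :=
      integrable_of_measurable_of_abs_le
        ((𝓜.stronglyMeasurable_integral_actionProb H hW).measurable.comp measurable_prodMk_left)
        fun x => 𝓜.abs_integral_actionProb_le H φ (erm φ x) θ
    have hi : Integrable (fun x => 𝓜.expectedCost H 𝓜.expert θ + (H : ℝ) ^ 2 *
        (1 - ∫ z, actionProb φ.1 (erm φ x) z.1 z.2 ∂(𝓜.demo H θ)))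
        (Measure.pi fun _ : Fin n => 𝓜.demo H θ) :=
      (integrable_const _).add (((integrable_const _).sub hx).const_mul _)
    calc ∫ x, 𝓜.expectedCost H (Kernel.prodMkLeft Θ (softmaxPolicy φ (erm φ x))) θ
          ∂(Measure.pi fun _ => 𝓜.demo H θ)
        ≤ ∫ x, (𝓜.expectedCost H 𝓜.expert θ + (H : ℝ) ^ 2 *
            (1 - ∫ z, actionProb φ.1 (erm φ x) z.1 z.2 ∂(𝓜.demo H θ)))
            ∂(Measure.pi fun _ => 𝓜.demo H θ) :=
          integral_mono_of_nonneg (Filter.Eventually.of_forall fun x =>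
            𝓜.expectedCost_nonneg H _ θ) hi (Filter.Eventually.of_forall fun x =>
              𝓜.expectedCost_softmaxPolicy_le H φ (erm φ x) hθ)
      _ = _ := by
          rw [integral_add_mul_one_sub (integrable_const _) hx, agreement]
          simp
  rw [integral_add_mul_one_sub hJ hQ] at key
  rw [excessCost]
  linarith

/-- The expected exponential of the negative training loss is at most the expected agreement, up
to the generalization error. -/
lemma integral_exp_neg_empLoss_le (η : Measure Θ) [IsProbabilityMeasure η] (H : ℕ) [NeZero H]
    (herm : IsERM Φ erm) {φ : Representation S d} (hφ : φ ∈ Φ) {R : ℝ} (hR : ∀ s, ‖φ.1 s‖ ≤ R)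
    (hn : n ≠ 0) :
    ∫ x, Real.exp (-empLoss φ (erm φ x) x) ∂(𝓜.taskDataLaw η H n) ≤
      ∫ θ, 𝓜.agreement H φ (erm φ) θ ∂η + 8 * Real.sqrt (Fintype.card A * R ^ 2 / n) := by
  have hn' : (0 : ℝ) < n := by positivity
  have hWm := herm.measurable φ hφ
  have hQ := 𝓜.integrable_agreement η H (φ := φ) hWm
  have hYm : Measurable fun x => Real.exp (-empLoss φ (erm φ x) x) :=
    Real.measurable_exp.comp (herm.measurable_empLoss hφ).neg
  have hY1 : ∀ x, |Real.exp (-empLoss φ (erm φ x) x)| ≤ 1 := fun x => by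
    rw [abs_of_pos (Real.exp_pos _)]
    exact Real.exp_le_one_iff.2 (neg_nonpos.2 (empLoss_nonneg _ _ _))
  rw [integral_taskDataLaw _ _ _ _ (integrable_of_measurable_of_abs_le hYm hY1)]
  have hθ : ∀ θ, ∫ x, Real.exp (-empLoss φ (erm φ x) x) ∂(iidKernel n (𝓜.demo H) θ) ≤
      𝓜.agreement H φ (erm φ) θ + 8 * Real.sqrt (Fintype.card A * R ^ 2 / n) := fun θ => by
    have hm : ∀ j, Measurable fun x : Fin n → S × A =>
        actionProb φ.1 (erm φ x) (x j).1 (x j).2 := fun j =>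
      (measurable_actionProb_uncurry φ hWm).comp
        (f := fun x : Fin n → S × A => (x, x j)) (by fun_prop)
    have hi : Integrable (fun x => ∑ j, actionProb φ.1 (erm φ x) (x j).1 (x j).2)
        (Measure.pi fun _ : Fin n => 𝓜.demo H θ) :=
      integrable_finsetSum _ fun j _ => integrable_of_measurable_of_abs_le (hm j) (C := 1) fun x =>
        by rw [abs_of_pos (actionProb_pos _ _ _ _)]; exact actionProb_le_one _ _ _ _
    have hgen := integral_sum_actionProb_sub_le φ hR (herm.mem φ hφ) hWm (𝓜.demo H θ)
    have h1 : ∫ x, Real.exp (-empLoss φ (erm φ x) x) ∂(Measure.pi fun _ => 𝓜.demo H θ) ≤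
        (1 / (n : ℝ)) * ∫ x, ∑ j, actionProb φ.1 (erm φ x) (x j).1 (x j).2
          ∂(Measure.pi fun _ => 𝓜.demo H θ) := by
      rw [← integral_const_mul]
      exact integral_mono (integrable_of_measurable_of_abs_le hYm hY1) (hi.const_mul _)
        fun x => exp_neg_empLoss_le hn φ (erm φ x) x
    have h2 : Real.sqrt (Fintype.card A * n * R ^ 2) =
        n * Real.sqrt (Fintype.card A * R ^ 2 / n) := by
      rw [show (Fintype.card A : ℝ) * n * R ^ 2 = n ^ 2 * (Fintype.card A * R ^ 2 / n) by
        field_simp, Real.sqrt_mul (by positivity), Real.sqrt_sq hn'.le]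
    rw [h2] at hgen
    refine h1.trans ?_
    rw [one_div, inv_mul_le_iff₀ hn', agreement]
    linarith
  calc _ ≤ ∫ θ, (𝓜.agreement H φ (erm φ) θ + 8 * Real.sqrt (Fintype.card A * R ^ 2 / n)) ∂η :=
        integral_mono_of_nonneg (Filter.Eventually.of_forall fun θ =>
          integral_nonneg fun x => (Real.exp_pos _).le) (hQ.add (integrable_const _))
          (Filter.Eventually.of_forall hθ)
    _ = _ := by
        rw [integral_add hQ (integrable_const _)]
        simp

/-- The training loss of a realizing representation is small on almost every training sample. -/
lemma ae_empLoss_erm_le (η : Measure Θ) [IsProbabilityMeasure η] (H : ℕ) [NeZero H] {γ : ℝ}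
    (hγ : γ < 1) (hdet : ∀ᵐ θ ∂η, 𝓜.DeterministicExpert θ) (herm : IsERM Φ erm)
    {φ : Representation S d} (hφ : φ ∈ Φ) (hreal : ∀ᵐ θ ∂η, 𝓜.Realizes φ γ θ) (hn : n ≠ 0) :
    ∀ᵐ x ∂(𝓜.taskDataLaw η H n), empLoss φ (erm φ x) x ≤ -Real.log (1 - γ) := by
  refine Measure.ae_comp_of_ae_ae (κ := iidKernel n (𝓜.demo H))
    (measurableSet_le (herm.measurable_empLoss hφ) measurable_const) ?_
  filter_upwards [hdet, hreal] with θ hθ hreal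
  obtain ⟨W, hW, hWp⟩ := hreal
  have hpm : Measurable fun z : S × A => actionProb φ.1 W z.1 z.2 :=
    (measurable_actionProb_uncurry (X := Unit) φ (W := fun _ => W)
      fun _ _ => measurable_const).comp (measurable_prodMk_left (x := ()))
  have hset : MeasurableSet {z : S × A | 1 - γ ≤ actionProb φ.1 W z.1 z.2} :=
    measurableSet_le measurable_const hpm
  have hz : ∀ᵐ z ∂(𝓜.demo H θ), 1 - γ ≤ actionProb φ.1 W z.1 z.2 := by
    rw [demo, Kernel.ae_compProd_iff hset]
    refine Filter.Eventually.of_forall fun s => ?_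
    obtain ⟨a, ha⟩ := hθ s
    rw [ha]
    exact (ae_dirac_iff (hset.preimage (measurable_prodMk_left (x := s)))).2 (hWp s a ha)
  have hx : ∀ᵐ x ∂(Measure.pi fun _ : Fin n => 𝓜.demo H θ), ∀ j,
      1 - γ ≤ actionProb φ.1 W (x j).1 (x j).2 :=
    ae_all_iff.2 fun j =>
      (measurePreserving_eval (fun _ : Fin n => 𝓜.demo H θ) j).quasiMeasurePreserving.ae hz
  change ∀ᵐ x ∂(Measure.pi fun _ : Fin n => 𝓜.demo H θ), _
  filter_upwards [hx] with x hx
  exact (herm.le φ hφ x W hW).trans (empLoss_le_of_le_actionProb hn (sub_pos.2 hγ) hx)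

instance (η : Measure Θ) [IsProbabilityMeasure η] (H T n : ℕ) [NeZero H] :
    IsProbabilityMeasure (𝓜.trainLaw η H T n) :=
  inferInstanceAs (IsProbabilityMeasure (Measure.pi fun _ : Fin T => 𝓜.taskDataLaw η H n))

lemma ae_outerLoss_le (η : Measure Θ) [IsProbabilityMeasure η] (H : ℕ) [NeZero H] {γ : ℝ}
    (hγ : γ < 1) (hdet : ∀ᵐ θ ∂η, 𝓜.DeterministicExpert θ) (herm : IsERM Φ erm)
    {φ : Representation S d} (hφ : φ ∈ Φ) (hreal : ∀ᵐ θ ∂η, 𝓜.Realizes φ γ θ) (hn : n ≠ 0)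
    {T : ℕ} (hT : T ≠ 0) :
    ∀ᵐ X ∂(𝓜.trainLaw η H T n), outerLoss φ X ≤ -Real.log (1 - γ) := by
  have hT' : (0 : ℝ) < T := by positivity
  have hX : ∀ᵐ X ∂(𝓜.trainLaw η H T n), ∀ t, empLoss φ (erm φ (X t)) (X t) ≤ -Real.log (1 - γ) :=
    ae_all_iff.2 fun t =>
      (measurePreserving_eval (fun _ : Fin T => 𝓜.taskDataLaw η H n) t).quasiMeasurePreserving.ae
        (𝓜.ae_empLoss_erm_le η H hγ hdet herm hφ hreal hn)
  filter_upwards [hX] with X hX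
  simp only [outerLoss, herm.iInf_empLoss hφ]
  calc _ ≤ (1 / (T : ℝ)) * ∑ _t : Fin T, -Real.log (1 - γ) :=
        mul_le_mul_of_nonneg_left (Finset.sum_le_sum fun t _ => hX t) (by positivity)
    _ = _ := by
        rw [Finset.sum_const, Finset.card_univ, Fintype.card_fin, nsmul_eq_mul]
        field_simp

/-- A representation with small expected agreement has a small outer loss with small
probability. -/
lemma trainLaw_outerLoss_le (η : Measure Θ) [IsProbabilityMeasure η] (H : ℕ) [NeZero H]
    (herm : IsERM Φ erm) {φ : Representation S d} (hφ : φ ∈ Φ) {R : ℝ} (hR0 : 0 < R)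
    (hR : ∀ s, ‖φ.1 s‖ ≤ R) (hn : n ≠ 0) {T : ℕ} (hT : T ≠ 0) {γ t : ℝ} (hγ : γ < 1) (ht : 0 ≤ t)
    (hbad : ∫ θ, 𝓜.agreement H φ (erm φ) θ ∂η + 8 * Real.sqrt (Fintype.card A * R ^ 2 / n) ≤
      1 - γ - t) :
    𝓜.trainLaw η H T n {X | outerLoss φ X ≤ -Real.log (1 - γ)} ≤
      ENNReal.ofReal (Real.exp (-(2 * T * t ^ 2 / (min 1 (2 * R)) ^ 2))) := by
  have hYm : Measurable fun x => Real.exp (-empLoss φ (erm φ x) x) :=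
    Real.measurable_exp.comp (herm.measurable_empLoss hφ).neg
  have h := measure_pi_average_ge_le (𝓜.taskDataLaw η H n) hYm (a := (Fintype.card A : ℝ)⁻¹)
    (r := min 1 (2 * R)) (lt_min one_pos (by positivity)) (herm.inv_card_le_exp hn hφ)
    (herm.exp_le_inv_card_add hn hφ hR) ht
    ((𝓜.integral_exp_neg_empLoss_le η H herm hφ hR hn).trans hbad) hT
  -- Exponentiating the bound on the outer loss and applying Jensen's inequality over tasks places X
  -- in the Hoeffding event with threshold 1 - γ.
  refine (measure_mono fun X hX => ?_).trans h
  have hX' : outerLoss φ X ≤ -Real.log (1 - γ) := hX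
  have h1 := exp_neg_outerLoss_le hT φ X
  simp only [herm.iInf_empLoss hφ] at h1
  refine le_trans ?_ h1
  rw [← Real.log_le_iff_le_exp (sub_pos.2 hγ)]
  linarith

end NewTask

end TaskFamily

/-! ### Calibration of the constants and the union bound -/

/-- The squared range r² is bounded in two ways: by 4R² against log N and by 1 against log(1/δ).
That is why R enters only one of the two conditions on T. The two terms use 1/4 and 1/16 of Tε²,
within the available 1/2. -/
lemma exp_neg_le_div_of_le {N δ R ε T : ℝ} (hN : 1 ≤ N) (hδ : 0 < δ) (hδ1 : δ < 1) (hR : 0 < R)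
    (h1 : 16 * (R ^ 2 * Real.log N) ≤ T * ε ^ 2) (h2 : 16 * Real.log (4 / δ) ≤ T * ε ^ 2) :
    Real.exp (-(2 * T * (ε / 2) ^ 2 / (min 1 (2 * R)) ^ 2)) ≤ δ / N := by
  set r := min 1 (2 * R)
  have hr : 0 < r := lt_min one_pos (by positivity)
  have hr1 : r ^ 2 ≤ 1 := pow_le_one₀ hr.le (min_le_left _ _)
  have hr2 : r ^ 2 ≤ 4 * R ^ 2 := by
    have := pow_le_pow_left₀ hr.le (min_le_right 1 (2 * R)) 2
    linarith
  have hlN : 0 ≤ Real.log N := Real.log_nonneg hN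
  have hlδ : Real.log δ ≤ 0 := Real.log_nonpos hδ.le hδ1.le
  have hl4 : Real.log (4 / δ) = Real.log 4 - Real.log δ := Real.log_div (by norm_num) hδ.ne'
  have h4 : 0 ≤ Real.log 4 := Real.log_nonneg (by norm_num)
  rw [← Real.le_log_iff_exp_le (by positivity), Real.log_div hδ.ne' (by positivity)]
  have key : Real.log N - Real.log δ ≤ 2 * T * (ε / 2) ^ 2 / r ^ 2 := by
    rw [le_div_iff₀ (by positivity)]
    have a1 : Real.log N * r ^ 2 ≤ Real.log N * (4 * R ^ 2) := mul_le_mul_of_nonneg_left hr2 hlN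
    have a2 : -Real.log δ * r ^ 2 ≤ -Real.log δ * 1 :=
      mul_le_mul_of_nonneg_left hr1 (neg_nonneg.2 hlδ)
    nlinarith
  linarith

namespace TaskFamily

variable {Θ S A : Type*} [MeasurableSpace Θ] [MeasurableSpace S] [MeasurableSpace A]
  [Fintype A] [MeasurableSingletonClass A]

/-- When all representations in the class vanish, every policy is uniform and no cost is lost
beyond the realizability error. -/
lemma excessCost_le_of_norm_le_zero (𝓜 : TaskFamily Θ S A) (η : Measure Θ) [IsProbabilityMeasure η]
    (H : ℕ) [NeZero H] {d n : ℕ} {γ : ℝ} {Φ : Finset (Representation S d)}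
    {erm : Representation S d → (Fin n → S × A) → Matrix A (Fin d) ℝ}
    (hΦ : ∀ φ ∈ Φ, ∀ s, ‖φ.1 s‖ ≤ 0) (hdet : ∀ᵐ θ ∂η, 𝓜.DeterministicExpert θ)
    (hreal : ∃ φ ∈ Φ, ∀ᵐ θ ∂η, 𝓜.Realizes φ γ θ) (herm : IsERM Φ erm) {φ : Representation S d}
    (hφ : φ ∈ Φ) : 𝓜.excessCost η H n erm φ ≤ H ^ 2 * γ := by
  have hunif : ∀ φ ∈ Φ, ∀ W ∈ FrobeniusBall A d, ∀ s a,
      actionProb φ.1 W s a = (Fintype.card A : ℝ)⁻¹ := fun φ hφ W hW s a => by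
    have := abs_actionProb_sub_inv_card_le (hΦ φ hφ) hW s a
    rw [mul_zero] at this
    exact sub_eq_zero.1 (abs_nonpos_iff.1 this)
  have hγ : 1 - γ ≤ (Fintype.card A : ℝ)⁻¹ := by
    obtain ⟨ψ, hψ, hreal⟩ := hreal
    obtain ⟨θ, hθ, W, hW, h⟩ := (hdet.and hreal).exists
    obtain ⟨s⟩ := nonempty_of_isProbabilityMeasure (𝓜.init θ)
    obtain ⟨a, ha⟩ := hθ s
    exact (h s a ha).trans_eq (hunif ψ hψ W hW s a)
  have hag : ∀ θ, 𝓜.agreement H φ (erm φ) θ = (Fintype.card A : ℝ)⁻¹ := fun θ => by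
    simp [agreement, hunif φ hφ _ (herm.mem φ hφ _)]
  refine (𝓜.excessCost_le η H hdet (herm.measurable φ hφ)).trans ?_
  simp only [hag, integral_const, probReal_univ, one_smul]
  exact mul_le_mul_of_nonneg_left (by linarith) (by positivity)

end TaskFamily

end ImitationLearning

theorem mainTheorem2 :
    ∃ c₁ c₂ : ℝ, 0 < c₁ ∧ 0 < c₂ ∧
      ∀ {Θ S A : Type*} [MeasurableSpace Θ] [MeasurableSpace S] [MeasurableSpace A]
        [Fintype A] [MeasurableSingletonClass A]
        (𝓜 : ImitationLearning.TaskFamily Θ S A) (η : MeasureTheory.Measure Θ)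
        [MeasureTheory.IsProbabilityMeasure η]
        (H : ℕ) [NeZero H] (d T n : ℕ) (R γ ε δ : ℝ)
        (Φ : Finset (ImitationLearning.Representation S d))
        (erm : ImitationLearning.Representation S d → (Fin n → S × A) → Matrix A (Fin d) ℝ)
        (φhat : (Fin T → Fin n → S × A) → ImitationLearning.Representation S d),
        (∀ φ ∈ Φ, ∀ s, ‖φ.1 s‖ ≤ R) →
        (∀ᵐ θ ∂η, 𝓜.DeterministicExpert θ) →
        γ < 1 / 2 →
        (∃ φ ∈ Φ, ∀ᵐ θ ∂η, 𝓜.Realizes φ γ θ) →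
        ImitationLearning.IsERM Φ erm →
        (∀ X, φhat X ∈ Φ ∧
          ∀ φ ∈ Φ, ImitationLearning.outerLoss (φhat X) X ≤ ImitationLearning.outerLoss φ X) →
        0 < ε → 0 < δ → δ < 1 →
        c₁ * max ((H : ℝ) ^ 4 * R ^ 2 * Real.log Φ.card / ε ^ 2)
            ((H : ℝ) ^ 4 * Real.log (4 / δ) / ε ^ 2) ≤ (T : ℝ) →
        c₂ * ((H : ℝ) ^ 4 * R ^ 2 * (Fintype.card A : ℝ) / ε ^ 2) ≤ (n : ℝ) →
        𝓜.trainLaw η H T n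
            {X | (H : ℝ) ^ 2 * γ + ε < 𝓜.excessCost η H n erm (φhat X)}
          ≤ ENNReal.ofReal δ := by
  refine ⟨16, 256, by norm_num, by norm_num, ?_⟩
  intro Θ S A _ _ _ _ _ 𝓜 η _ H _ d T n R γ ε δ Φ erm φhat hΦ hdet hγ hreal herm hφhat hε hδ hδ1
    hTle hnle
  have hA : Nonempty A := 𝓜.nonempty_action η
  have hH : (0 : ℝ) < H := by exact_mod_cast Nat.pos_of_ne_zero (NeZero.ne H)
  -- When R = 0 the condition on n allows n = 0, and for R ≤ 0 the range min(1, 2R) is not positive,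
  -- so this case is treated separately.
  rcases le_or_gt R 0 with hR | hR
  · have hempty : {X | (H : ℝ) ^ 2 * γ + ε < 𝓜.excessCost η H n erm (φhat X)} = ∅ :=
      Set.eq_empty_of_forall_notMem fun X hX => by
        have hX' : (H : ℝ) ^ 2 * γ + ε < 𝓜.excessCost η H n erm (φhat X) := hX
        have := 𝓜.excessCost_le_of_norm_le_zero η H (fun φ hφ s => (hΦ φ hφ s).trans hR) hdet
          hreal herm (hφhat X).1
        linarith
    rw [hempty, measure_empty]
    exact zero_le
  obtain ⟨ψ, hψ, hreal⟩ := hreal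
  have hK : (0 : ℝ) < Fintype.card A := by exact_mod_cast Fintype.card_pos
  have hn' : (0 : ℝ) < n := lt_of_lt_of_le (by positivity) hnle
  have hn : n ≠ 0 := by rintro rfl; simp at hn'
  have hlog4 : 0 < Real.log (4 / δ) := Real.log_pos (by rw [lt_div_iff₀ hδ]; linarith)
  have hT1 := (mul_le_mul_of_nonneg_left (le_max_left _ _) (by norm_num)).trans hTle
  have hT2 := (mul_le_mul_of_nonneg_left (le_max_right _ _) (by norm_num)).trans hTle
  have hT' : (0 : ℝ) < T := lt_of_lt_of_le (by positivity) hT2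
  have hT : T ≠ 0 := by rintro rfl; simp at hT'
  set e : ℝ := ε / H ^ 2 with he
  have he0 : 0 < e := by positivity
  have he2 : e ^ 2 = ε ^ 2 / H ^ 4 := by rw [he]; ring
  have hN : (1 : ℝ) ≤ Φ.card := by exact_mod_cast Finset.card_pos.2 ⟨ψ, hψ⟩
  have hT1' : 16 * (R ^ 2 * Real.log Φ.card) ≤ T * e ^ 2 := by
    rw [he2, ← mul_div_assoc, le_div_iff₀ (by positivity)]
    rw [← mul_div_assoc, div_le_iff₀ (by positivity)] at hT1
    linarith
  have hT2' : 16 * Real.log (4 / δ) ≤ T * e ^ 2 := by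
    rw [he2, ← mul_div_assoc, le_div_iff₀ (by positivity)]
    rw [← mul_div_assoc, div_le_iff₀ (by positivity)] at hT2
    linarith
  -- The generalization error takes half of the slack e, leaving e/2 for Hoeffding. This fixes the
  -- second constant as 256 = 16².
  have hgap : 8 * Real.sqrt (Fintype.card A * R ^ 2 / n) ≤ e / 2 := by
    have : Real.sqrt (Fintype.card A * R ^ 2 / n) ≤ e / 16 := by
      refine Real.sqrt_le_iff.2 ⟨by positivity, ?_⟩
      rw [div_pow, he2, div_le_div_iff₀ hn' (by norm_num), div_mul_eq_mul_div,
        le_div_iff₀ (by positivity)]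
      rw [← mul_div_assoc, div_le_iff₀ (by positivity)] at hnle
      linarith
    linarith
  have hexp := ImitationLearning.exp_neg_le_div_of_le hN hδ hδ1 hR hT1' hT2'
  classical
  set bad := Φ.filter fun φ => (H : ℝ) ^ 2 * γ + ε < 𝓜.excessCost η H n erm φ
  have hbound : ∀ φ ∈ bad, 𝓜.trainLaw η H T n
      {X | ImitationLearning.outerLoss φ X ≤ -Real.log (1 - γ)} ≤
      ENNReal.ofReal (δ / Φ.card) := fun φ hφ => by
    obtain ⟨hφΦ, hφ⟩ := Finset.mem_filter.1 hφ
    refine (𝓜.trainLaw_outerLoss_le η H herm hφΦ hR (hΦ φ hφΦ) hn hT (γ := γ) (t := e / 2)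
      (by linarith) (by positivity) ?_).trans (ENNReal.ofReal_le_ofReal hexp)
    have h1 := hφ.trans_le (𝓜.excessCost_le η H hdet (herm.measurable φ hφΦ))
    have h2 : ε = H ^ 2 * e := by rw [he]; field_simp
    rw [h2, ← mul_add] at h1
    have h3 := lt_of_mul_lt_mul_left h1 (by positivity)
    linarith
  have hae := 𝓜.ae_outerLoss_le η H (by linarith) hdet herm hψ hreal hn hT
  -- The loss of φ̂ is at most that of ψ. The failure event is merely covered, so neither it nor φ̂
  -- has to be measurable.
  have hsub : {X | (H : ℝ) ^ 2 * γ + ε < 𝓜.excessCost η H n erm (φhat X)} ≤ᵐ[𝓜.trainLaw η H T n]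
      ⋃ φ ∈ bad, {X | ImitationLearning.outerLoss φ X ≤ -Real.log (1 - γ)} := by
    filter_upwards [hae] with X hX hXbad
    exact Set.mem_biUnion (Finset.mem_filter.2 ⟨(hφhat X).1, hXbad⟩)
      (((hφhat X).2 ψ hψ).trans hX)
  calc _ ≤ 𝓜.trainLaw η H T n (⋃ φ ∈ bad, {X | ImitationLearning.outerLoss φ X ≤ -Real.log (1 - γ)}) :=
        measure_mono_ae hsub
    _ ≤ ∑ φ ∈ bad, 𝓜.trainLaw η H T n {X | ImitationLearning.outerLoss φ X ≤ -Real.log (1 - γ)} :=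
        measure_biUnion_finset_le _ _
    _ ≤ ∑ _φ ∈ Φ, ENNReal.ofReal (δ / Φ.card) :=
        (Finset.sum_le_sum hbound).trans
          (Finset.sum_le_sum_of_subset (Finset.filter_subset _ _))
    _ = ENNReal.ofReal δ := by
        rw [Finset.sum_const, nsmul_eq_mul, ← ENNReal.ofReal_natCast,
          ← ENNReal.ofReal_mul (by positivity)]
        congr 1
        field_simp
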